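/- Let $J=\begin{pmatrix}0&1\\-1&0\end{pmatrix}$ and let $Q:\mathbb R\to\mathbb R^{2\times2}$ be symmetric with $\pi$-periodic, (locally) absolutely continuous entries. For real $\lambda$ consider $JY'+QY=\lambda Y$; let $\mathbb Y(\cdot,\lambda)$ be its matrix solution with $\mathbb Y(0,\lambda)=I$ and let $\Delta(\lambda)=\operatorname{trace}\mathbb Y(\pi,\lambda)$. Write the solution with initial value $(1,0)^T$ as $R(\cos\theta,\sin\theta)^T$ with $R>0$ and $\theta=\theta(z,\lambda)$ continuous in $z$, $\theta(0,\lambda)=0$, and for $n\in\mathbb Z$ let $\mu_n$ be the unique real number with $\theta(\pi,\mu_n)=n\pi$. For $k\in\mathbb Z$ let $[\lambda_{2k-1},\lambda_{2k}]$ be the connected component of $\{\lambda\in\mathbb R:\Delta(\lambda)\ge2\}$ that contains $\mu_{2k}$, and let $[\lambda'_{2k-1},\lambda'_{2k}]$ be the connected component of $\{\lambda\in\mathbb R:\Delta(\lambda)\le-2\}$ that contains $\mu_{2k-1}$; the $\lambda_j$ and the $\lambda_j'$ are the eigenvalues of the periodic and the antiperiodic problem on $[0,\pi]$. The instability intervals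 are $I_{2k}=(\lambda_{2k-1},\lambda_{2k})$ and $I_{2k-1}=(\lambda'_{2k-1},\lambda'_{2k})$, $k\in\mathbb Z$. If all instability intervals are empty, then $Q=pI$, where $p=\tfrac12\operatorname{trace}(Q)$. In this case, for all $k\in\mathbb Z$, $$\lambda_{2k-1}=\lambda_{2k}=2k+\frac1\pi\int_0^\pi p\,dt=1+\lambda'_{2k-1}=1+\lambda'_{2k}.$$ -/

import Mathlib

open Real Set

noncomputable section

namespace CanonicalSystem

/-- The matrix `J` of the canonical system. -/
def J : Matrix (Fin 2) (Fin 2) ℝ := !![0, 1; -1, 0]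

/-- The potential `Q` is real symmetric and its entries are `π`-periodic and
absolutely continuous (on every compact interval). -/
structure IsPotential (Q : ℝ → Matrix (Fin 2) (Fin 2) ℝ) : Prop where
  symm : ∀ z, (Q z).IsSymm
  periodic : ∀ i j, Function.Periodic (fun z => Q z i j) π
  absCont : ∀ i j a b, AbsolutelyContinuousOnInterval (fun z => Q z i j) a b

/-- `Y` is a solution on `ℝ` of `J Y' + Q Y = lam Y`.  The potentials considered are
continuous, so that absolutely continuous (almost everywhere) solutions are exactly the
classical ones. -/
def IsSolution (Q : ℝ → Matrix (Fin 2) (Fin 2) ℝ) (lam : ℝ) (Y : ℝ → Fin 2 → ℝ) : Prop :=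
  Differentiable ℝ Y ∧
    ∀ z, Matrix.mulVec J (deriv Y z) + Matrix.mulVec (Q z) (Y z) = lam • Y z

/-- `F` is the matrix solution `[Y₁ Y₂]` with `F 0 = I`: its columns are solutions. -/
def IsFundamentalMatrix (Q : ℝ → Matrix (Fin 2) (Fin 2) ℝ) (lam : ℝ)
    (F : ℝ → Matrix (Fin 2) (Fin 2) ℝ) : Prop :=
  F 0 = 1 ∧ ∀ j, IsSolution Q lam (fun z i => F z i j)

/-- The matrix solution with initial value `I`; it exists and is unique for continuous `Q`. -/
def fundamentalMatrix (Q : ℝ → Matrix (Fin 2) (Fin 2) ℝ) (lam : ℝ) :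
    ℝ → Matrix (Fin 2) (Fin 2) ℝ :=
  Classical.epsilon (IsFundamentalMatrix Q lam)

/-- The discriminant: the trace of the monodromy matrix. -/
def discriminant (Q : ℝ → Matrix (Fin 2) (Fin 2) ℝ) (lam : ℝ) : ℝ :=
  (fundamentalMatrix Q lam π).trace

/-- `θ` is the angular part of the solution `Ψ` with `Ψ(0) = (cos γ, sin γ)`: the continuous
function with `θ 0 = γ` and `Ψ = R (cos θ, sin θ)` where `R > 0`. -/
def IsAngularPart (Q : ℝ → Matrix (Fin 2) (Fin 2) ℝ) (lam γ : ℝ) (θ : ℝ → ℝ) : Prop :=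
  Continuous θ ∧ θ 0 = γ ∧
    ∃ (Ψ : ℝ → Fin 2 → ℝ) (R : ℝ → ℝ), IsSolution Q lam Ψ ∧ Ψ 0 = ![cos γ, sin γ] ∧
      ∀ z, 0 < R z ∧ Ψ z = ![R z * cos (θ z), R z * sin (θ z)]

/-- The angular part `θ(z, lam, γ)`; it exists and is unique for continuous `Q`. -/
def angularPart (Q : ℝ → Matrix (Fin 2) (Fin 2) ℝ) (lam γ : ℝ) : ℝ → ℝ :=
  Classical.epsilon (IsAngularPart Q lam γ)

/-- The eigenvalue `μ_n` of the problem with boundary condition `y₂(0) = y₂(π) = 0`: the unique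
real number with `θ(π, μ_n, 0) = n π`. -/
def mu (Q : ℝ → Matrix (Fin 2) (Fin 2) ℝ) (n : ℤ) : ℝ :=
  Classical.epsilon (fun m : ℝ => angularPart Q m 0 π = n * π)

/-- The compact interval `[λ_{2k-1}, λ_{2k}]`: the connected component of `{Δ ≥ 2}` that
contains `μ_{2k}`. -/
def periodicComponent (Q : ℝ → Matrix (Fin 2) (Fin 2) ℝ) (k : ℤ) : Set ℝ :=
  connectedComponentIn {x : ℝ | 2 ≤ discriminant Q x} (mu Q (2 * k))

/-- The compact interval `[λ'_{2k-1}, λ'_{2k}]`: the connected component of `{Δ ≤ -2}` that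
contains `μ_{2k-1}`. -/
def antiperiodicComponent (Q : ℝ → Matrix (Fin 2) (Fin 2) ℝ) (k : ℤ) : Set ℝ :=
  connectedComponentIn {x : ℝ | discriminant Q x ≤ -2} (mu Q (2 * k - 1))

/-- The periodic eigenvalue `λ_j`: for `j = 2k` the right, for `j = 2k - 1` the left end point of
the component of `{Δ ≥ 2}` that contains `μ_{2k}`. -/
def periodicEigenvalue (Q : ℝ → Matrix (Fin 2) (Fin 2) ℝ) (j : ℤ) : ℝ :=
  if Even j then sSup (periodicComponent Q (j / 2))
  else sInf (periodicComponent Q ((j + 1) / 2))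

/-- The antiperiodic eigenvalue `λ'_j`: for `j = 2k` the right, for `j = 2k - 1` the left end
point of the component of `{Δ ≤ -2}` that contains `μ_{2k-1}`. -/
def antiperiodicEigenvalue (Q : ℝ → Matrix (Fin 2) (Fin 2) ℝ) (j : ℤ) : ℝ :=
  if Even j then sSup (antiperiodicComponent Q (j / 2))
  else sInf (antiperiodicComponent Q ((j + 1) / 2))

/-- The instability intervals `I_{2k} = (λ_{2k-1}, λ_{2k})` and
`I_{2k-1} = (λ'_{2k-1}, λ'_{2k})`. -/
def instabilityInterval (Q : ℝ → Matrix (Fin 2) (Fin 2) ℝ) (n : ℤ) : Set ℝ :=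
  if Even n then Ioo (periodicEigenvalue Q (n - 1)) (periodicEigenvalue Q n)
  else Ioo (antiperiodicEigenvalue Q n) (antiperiodicEigenvalue Q (n + 1))

end CanonicalSystem

end

open Filter Topology MeasureTheory
open scoped NNReal

namespace CanonicalSystem

/-! ### Auxiliary facts from real analysis -/

/-! The proof measures the stability bands `(mu Q n, mu Q (n + 1))`. At `mu Q n` the monodromy
matrix is triangular with determinant one, so `(-1)ⁿ Δ ≥ 2` there. When the gaps are empty, each
component shrinks to the point `mu Q n`, and `|Δ| < 2` on every band.

`(-1)ⁿ Δ'` is minus the integral of a quadratic form with coefficients from the monodromy matrix,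
summed over the rows of the fundamental matrix. By the arithmetic-geometric mean inequality the
integrand is at least `√(4 - Δ²)` (`le_quadratic_sum`). So `arccos ((-1)ⁿ Δ / 2)`, which climbs from
`0` to `π` across a band, has derivative at least `π`, and the band has length at most `1`. Length
`1` forces equality at some parameter, which makes the fundamental matrix a rotation and `Q` scalar
(`mu_sub_le_one_and_eq_smul_one`).

Hence `mu Q n - n` is antitone in `n`. A Riemann–Lebesgue argument for the angle equation shows that
it has the same limit, the mean of half the trace, at both ends (`exists_abs_mu_sub_le`). It is
therefore constant: every band has length exactly `1`, which gives both the scalar form of `Q` and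
the eigenvalues. -/

/-- Global existence for a scalar equation with bounded, Lipschitz right-hand side. -/
theorem exists_forall_hasDerivAt_of_bounded_of_lipschitz {v : ℝ → ℝ → ℝ} {K L : ℝ≥0}
    (hlip : ∀ t, LipschitzWith K (v t)) (hcont : ∀ x, Continuous fun t => v t x)
    (hbd : ∀ t x, ‖v t x‖ ≤ L) (x₀ : ℝ) :
    ∃ f : ℝ → ℝ, f 0 = x₀ ∧ ∀ t, HasDerivAt f (v t (f t)) t := by
  have hloc : ∀ n : ℕ, ∃ f : ℝ → ℝ, f 0 = x₀ ∧
      ∀ t ∈ Ioo (-((n : ℝ) + 1)) ((n : ℝ) + 1), HasDerivAt f (v t (f t)) t := by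
    intro n
    have hn : (0 : ℝ) ≤ (n : ℝ) + 1 := by positivity
    have h0 : (0 : ℝ) ∈ Icc (-((n : ℝ) + 1)) ((n : ℝ) + 1) := ⟨by linarith, hn⟩
    -- Since `v` is bounded by `L` everywhere, the ball of radius `L (n + 1)` contains the whole
    -- trajectory and the time interval need not shrink.
    have hPL : IsPicardLindelof v (⟨0, h0⟩ : Icc (-((n : ℝ) + 1)) ((n : ℝ) + 1)) x₀
        (L * (n + 1)) 0 L K :=
      { lipschitzOnWith := fun t _ => (hlip t).lipschitzOnWith
        continuousOn := fun x _ => (hcont x).continuousOn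
        norm_le := fun t _ x _ => hbd t x
        mul_max_le := by simp }
    obtain ⟨f, hf0, hf⟩ := hPL.exists_eq_forall_mem_Icc_hasDerivWithinAt₀
    exact ⟨f, hf0, fun t ht =>
      (hf t (Ioo_subset_Icc_self ht)).hasDerivAt (Icc_mem_nhds ht.1 ht.2)⟩
  choose f hf0 hf using hloc
  have huniq : ∀ (m n : ℕ) (t : ℝ), |t| < m + 1 → |t| < n + 1 → f m t = f n t := by
    intro m n t hm hn
    wlog hmn : m ≤ n generalizing m n
    · exact (this n m hn hm (le_of_not_ge hmn)).symm
    have hmn' : (m : ℝ) ≤ n := by exact_mod_cast hmn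
    have hsub : Ioo (-((m : ℝ) + 1)) ((m : ℝ) + 1) ⊆ Ioo (-((n : ℝ) + 1)) ((n : ℝ) + 1) :=
      Ioo_subset_Ioo (by linarith) (by linarith)
    refine ODE_solution_unique_of_mem_Ioo (v := v) (s := fun _ => univ) (K := K) (t₀ := 0)
      (fun t _ => (hlip t).lipschitzOnWith) ⟨by linarith [m.cast_nonneg (α := ℝ)], by positivity⟩
      (fun s hs => ⟨hf m s hs, mem_univ _⟩) (fun s hs => ⟨hf n s (hsub hs), mem_univ _⟩)
      (by rw [hf0, hf0]) (abs_lt.mp hm)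
  have hceil : ∀ t : ℝ, |t| < (⌈|t|⌉₊ : ℝ) + 1 := fun t => by linarith [Nat.le_ceil |t|]
  -- The extra `1` in the intervals makes `t` an interior point for its own index, so `huniq`
  -- identifies the glued function with one `f n` near `t`.
  refine ⟨fun t => f ⌈|t|⌉₊ t, hf0 _, fun t => ?_⟩
  have hmem : Ioo (-((⌈|t|⌉₊ : ℝ) + 1)) ((⌈|t|⌉₊ : ℝ) + 1) ∈ 𝓝 t :=
    Ioo_mem_nhds (abs_lt.mp (hceil t)).1 (abs_lt.mp (hceil t)).2
  refine (hf ⌈|t|⌉₊ t (abs_lt.mp (hceil t))).congr_of_eventuallyEq ?_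
  filter_upwards [hmem] with s hs
  exact huniq _ _ s (hceil s) (abs_lt.mpr hs)

/-- A function that decreases whenever it takes the value `B` cannot return to `B`. -/
theorem lt_of_deriv_neg_of_eq {f f' : ℝ → ℝ} {a b B : ℝ} (hab : a < b)
    (hf : ∀ t ∈ Icc a b, HasDerivAt f (f' t) t) (ha : f a ≤ B)
    (h : ∀ t ∈ Icc a b, f t = B → f' t < 0) : f b < B := by
  have hle : ∀ ⦃x⦄, x ∈ Icc a b → f x ≤ B :=
    image_le_of_deriv_right_lt_deriv_boundary (B := fun _ => B) (B' := fun _ => 0)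
      (fun t ht => (hf t ht).continuousAt.continuousWithinAt)
      (fun t ht => (hf t (Ico_subset_Icc_self ht)).hasDerivWithinAt) ha
      (fun x => hasDerivAt_const x B) (fun t ht => h t (Ico_subset_Icc_self ht))
  have hb : b ∈ Icc a b := right_mem_Icc.mpr hab.le
  -- If `f b = B`, the negative derivative at `b` puts `f` above `B` just to the left, against
  -- `hle`.
  refine lt_of_le_of_ne (hle hb) fun hbB => ?_
  have hslope := hasDerivAt_iff_tendsto_slope.mp (hf b hb)
  have hev : ∀ᶠ x in 𝓝[<] b, slope f b x < 0 :=
    (hslope.mono_left (nhdsWithin_mono b fun x hx => ne_of_lt hx)).eventually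
      (gt_mem_nhds (h b hb hbB))
  obtain ⟨x, hx, hxa, hxb⟩ := (hev.and (Ioo_mem_nhdsLT hab)).exists
  rw [slope_def_field, div_lt_iff_of_neg (by linarith)] at hx
  have := hle ⟨hxa.le, hxb.le⟩
  linarith

/-- A Riemann–Lebesgue lemma: a continuous function integrates to almost zero against
`cos (2θ - α)` if `θ` has a large derivative, up to a bounded error. -/
theorem exists_abs_integral_mul_cos_le {q : ℝ → ℝ} (hq : Continuous q) (C α : ℝ) {ε : ℝ}
    (hε : 0 < ε) :
    ∃ Λ : ℝ, ∀ (lam : ℝ) (θ f : ℝ → ℝ), Λ ≤ |lam| → Continuous f →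
      (∀ t, HasDerivAt θ (lam - f t) t) → (∀ t, |f t| ≤ C) →
      |∫ t in (0 : ℝ)..π, q t * cos (2 * θ t - α)| ≤ ε := by
  have hπ := pi_pos
  -- A polynomial replaces the merely continuous `q`, so that integration by parts is available.
  obtain ⟨P, hP⟩ := exists_polynomial_near_of_continuousOn 0 π q hq.continuousOn (ε / (2 * π))
    (by positivity)
  obtain ⟨B, hB⟩ := isCompact_Icc.exists_bound_of_continuousOn (s := Icc 0 π) (f := fun t => P.eval t)
    P.continuous.continuousOn
  obtain ⟨B', hB'⟩ := isCompact_Icc.exists_bound_of_continuousOn (s := Icc 0 π)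
    (f := fun t => P.derivative.eval t) P.derivative.continuous.continuousOn
  have h0 : (0 : ℝ) ∈ Icc 0 π := ⟨le_rfl, hπ.le⟩
  have h1 : π ∈ Icc 0 π := ⟨hπ.le, le_rfl⟩
  have hB0 : 0 ≤ B := (norm_nonneg _).trans (hB 0 h0)
  have hB0' : 0 ≤ B' := (norm_nonneg _).trans (hB' 0 h0)
  set A := B + B' * π + B * |C| * π with hA
  have hA0 : 0 ≤ A := by positivity
  refine ⟨2 * A / ε + 1, fun lam θ f hlam hf hθ hfC => ?_⟩
  have hθc : Continuous θ := continuous_iff_continuousAt.mpr fun t => (hθ t).continuousAt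
  have hlam0 : 0 < |lam| := lt_of_lt_of_le (by positivity) hlam
  -- Differentiating the sine releases the factor `θ' = lam - f`; so `lam * ∫ P cos` equals boundary
  -- terms and integrals bounded independently of `lam`, collected in `A`.
  have hder : ∀ t, HasDerivAt (fun t => P.eval t * (sin (2 * θ t - α) / 2))
      (P.derivative.eval t * (sin (2 * θ t - α) / 2)
        + P.eval t * (cos (2 * θ t - α) * (lam - f t))) t := by
    intro t
    have h2 : HasDerivAt (fun t => sin (2 * θ t - α) / 2) (cos (2 * θ t - α) * (lam - f t)) t := by
      convert! ((((hθ t).const_mul 2).sub_const α).sin).div_const 2 using 1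
      ring
    exact (P.hasDerivAt t).mul h2
  have hPc : Continuous fun t => P.eval t := P.continuous
  have hPc' : Continuous fun t => P.derivative.eval t := P.derivative.continuous
  have hFTC := intervalIntegral.integral_eq_sub_of_hasDerivAt (a := 0) (b := π)
    (fun t _ => hder t) ((by fun_prop : Continuous _).intervalIntegrable _ _)
  have hsplit : (∫ t in (0 : ℝ)..π, (P.derivative.eval t * (sin (2 * θ t - α) / 2)
        + P.eval t * (cos (2 * θ t - α) * (lam - f t)))) =
      (∫ t in (0 : ℝ)..π, P.derivative.eval t * (sin (2 * θ t - α) / 2))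
      + lam * (∫ t in (0 : ℝ)..π, P.eval t * cos (2 * θ t - α))
      - ∫ t in (0 : ℝ)..π, P.eval t * cos (2 * θ t - α) * f t := by
    rw [← intervalIntegral.integral_const_mul, ← intervalIntegral.integral_add,
      ← intervalIntegral.integral_sub]
    · congr 1; ext t; ring
    all_goals exact (by fun_prop : Continuous _).intervalIntegrable _ _
  have hI1 : |∫ t in (0 : ℝ)..π, P.derivative.eval t * (sin (2 * θ t - α) / 2)| ≤ B' / 2 * π := by
    have := intervalIntegral.norm_integral_le_of_norm_le_const (a := 0) (b := π) (C := B' / 2)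
      (f := fun t => P.derivative.eval t * (sin (2 * θ t - α) / 2)) (fun t ht => by
        rw [uIoc_of_le hπ.le] at ht
        rw [norm_mul, norm_div, Real.norm_eq_abs (sin _), Real.norm_ofNat]
        have := hB' t (Ioc_subset_Icc_self ht)
        have := abs_sin_le_one (2 * θ t - α)
        calc _ ≤ B' * (1 / 2) := by gcongr
          _ = _ := by ring)
    simpa [abs_of_pos hπ] using this
  have hI2 : |∫ t in (0 : ℝ)..π, P.eval t * cos (2 * θ t - α) * f t| ≤ B * |C| * π := by
    have := intervalIntegral.norm_integral_le_of_norm_le_const (a := 0) (b := π) (C := B * |C|)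
      (f := fun t => P.eval t * cos (2 * θ t - α) * f t) (fun t ht => by
        rw [uIoc_of_le hπ.le] at ht
        rw [norm_mul, norm_mul, Real.norm_eq_abs (cos _), Real.norm_eq_abs (f t)]
        have h3 := hB t (Ioc_subset_Icc_self ht)
        have h4 := abs_cos_le_one (2 * θ t - α)
        have h5 := (hfC t).trans (le_abs_self C)
        calc _ ≤ B * 1 * |C| := by gcongr
          _ = _ := by ring)
    simpa [abs_of_pos hπ] using this
  have hbdry : ∀ t ∈ Icc 0 π, |P.eval t * (sin (2 * θ t - α) / 2)| ≤ B / 2 := by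
    intro t ht
    rw [abs_mul, abs_div, abs_two]
    have := hB t ht
    rw [Real.norm_eq_abs] at this
    have := abs_sin_le_one (2 * θ t - α)
    calc _ ≤ B * (1 / 2) := by gcongr
      _ = _ := by ring
  have hmain : |lam| * |∫ t in (0 : ℝ)..π, P.eval t * cos (2 * θ t - α)| ≤ A := by
    rw [← abs_mul]
    have e : lam * (∫ t in (0 : ℝ)..π, P.eval t * cos (2 * θ t - α)) =
        P.eval π * (sin (2 * θ π - α) / 2) - P.eval 0 * (sin (2 * θ 0 - α) / 2)
        - (∫ t in (0 : ℝ)..π, P.derivative.eval t * (sin (2 * θ t - α) / 2))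
        + ∫ t in (0 : ℝ)..π, P.eval t * cos (2 * θ t - α) * f t := by linarith
    rw [e, abs_le]
    have h3 := abs_le.mp (hbdry π h1)
    have h4 := abs_le.mp (hbdry 0 h0)
    have h5 := abs_le.mp hI1
    have h6 := abs_le.mp hI2
    have : 0 ≤ B' * π := by positivity
    constructor <;> linarith
  have hPsmall : |∫ t in (0 : ℝ)..π, P.eval t * cos (2 * θ t - α)| ≤ ε / 2 := by
    have h3 : 2 * A / ε ≤ |lam| := by linarith
    rw [div_le_iff₀ hε] at h3
    by_contra! hcon
    have : |lam| * (ε / 2) < A := lt_of_lt_of_le (by gcongr) hmain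
    linarith
  have hdiff : |∫ t in (0 : ℝ)..π, (q t - P.eval t) * cos (2 * θ t - α)| ≤ ε / 2 := by
    have := intervalIntegral.norm_integral_le_of_norm_le_const (a := 0) (b := π)
      (C := ε / (2 * π)) (f := fun t => (q t - P.eval t) * cos (2 * θ t - α)) (fun t ht => by
        rw [uIoc_of_le hπ.le] at ht
        rw [norm_mul, Real.norm_eq_abs, Real.norm_eq_abs (cos _), abs_sub_comm]
        have h3 := (hP t (Ioc_subset_Icc_self ht)).le
        have h4 := abs_cos_le_one (2 * θ t - α)
        calc _ ≤ ε / (2 * π) * 1 := by gcongr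
          _ = _ := by ring)
    rw [sub_zero, abs_of_pos hπ, Real.norm_eq_abs] at this
    refine this.trans (le_of_eq ?_)
    field_simp
  have e : (∫ t in (0 : ℝ)..π, q t * cos (2 * θ t - α)) =
      (∫ t in (0 : ℝ)..π, (q t - P.eval t) * cos (2 * θ t - α))
      + ∫ t in (0 : ℝ)..π, P.eval t * cos (2 * θ t - α) := by
    rw [← intervalIntegral.integral_add]
    · congr 1; ext t; ring
    all_goals exact (by fun_prop : Continuous _).intervalIntegrable _ _
  rw [e]
  exact (abs_add_le _ _).trans (by linarith)

end CanonicalSystem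

namespace CanonicalSystem

variable {Q : ℝ → Matrix (Fin 2) (Fin 2) ℝ} {lam mu : ℝ}

/-! ### The potential -/

theorem IsPotential.apply_one_zero (hQ : IsPotential Q) (z : ℝ) : Q z 1 0 = Q z 0 1 :=
  (hQ.symm z).apply 0 1

theorem IsPotential.continuous (hQ : IsPotential Q) (i j : Fin 2) : Continuous fun z => Q z i j := by
  refine continuous_iff_continuousAt.mpr fun z => ?_
  refine (hQ.absCont i j (z - 1) (z + 1)).continuousOn.continuousAt ?_
  rw [uIcc_of_le (by linarith)]
  exact Icc_mem_nhds (by linarith) (by linarith)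

theorem IsPotential.exists_bound (hQ : IsPotential Q) :
    ∃ C : ℝ, 0 ≤ C ∧ ∀ z i j, |Q z i j| ≤ C := by
  have h : ∀ i j, ∃ C : ℝ, ∀ z, |Q z i j| ≤ C := fun i j => by
    obtain ⟨C, hC⟩ := ((hQ.periodic i j).isBounded_of_continuous pi_ne_zero
      (hQ.continuous i j)).exists_norm_le
    exact ⟨C, fun z => hC _ (mem_range_self z)⟩
  choose C hC using h
  have hC0 : ∀ i j, 0 ≤ C i j := fun i j => (abs_nonneg _).trans (hC i j 0)
  refine ⟨∑ i, ∑ j, C i j, Finset.sum_nonneg fun i _ => Finset.sum_nonneg fun j _ => hC0 i j,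
    fun z i j => (hC i j z).trans ?_⟩
  exact (Finset.single_le_sum (f := fun j => C i j) (fun j _ => hC0 i j) (Finset.mem_univ j)).trans
    (Finset.single_le_sum (f := fun i => ∑ j, C i j)
      (fun i _ => Finset.sum_nonneg fun j _ => hC0 i j) (Finset.mem_univ i))

/-! ### Solutions -/

/-- The system solved for `Y'` with `J⁻¹ = -J`, the symmetry of `Q` removing the entry `Q z 1 0`. -/
theorem isSolution_iff (hQ : IsPotential Q) {Y : ℝ → Fin 2 → ℝ} :
    IsSolution Q lam Y ↔ ∀ z,
      HasDerivAt (fun z => Y z 0) (Q z 0 1 * Y z 0 + (Q z 1 1 - lam) * Y z 1) z ∧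
      HasDerivAt (fun z => Y z 1) ((lam - Q z 0 0) * Y z 0 - Q z 0 1 * Y z 1) z := by
  constructor
  · rintro ⟨hd, he⟩ z
    have h := hasDerivAt_pi.mp (hd z).hasDerivAt
    have e0 := congrFun (he z) 0
    have e1 := congrFun (he z) 1
    simp [J, dotProduct, Fin.sum_univ_two, hQ.apply_one_zero z] at e0 e1
    refine ⟨(h 0).congr_deriv ?_, (h 1).congr_deriv ?_⟩ <;> linarith
  · intro h
    have hd : ∀ z, HasDerivAt Y ![Q z 0 1 * Y z 0 + (Q z 1 1 - lam) * Y z 1,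
        (lam - Q z 0 0) * Y z 0 - Q z 0 1 * Y z 1] z := fun z => by
      refine hasDerivAt_pi.mpr fun i => ?_
      fin_cases i
      · exact (h z).1
      · exact (h z).2
    refine ⟨fun z => (hd z).differentiableAt, fun z => ?_⟩
    rw [(hd z).deriv]
    ext i
    fin_cases i
    · simp [J]
      ring
    · simp [J, hQ.apply_one_zero z]
      ring

theorem IsSolution.continuous {Y : ℝ → Fin 2 → ℝ} (hY : IsSolution Q lam Y) (i : Fin 2) :
    Continuous fun z => Y z i :=
  (continuous_apply i).comp hY.1.continuous

/-- The derivative of the Wronskian of solutions for different spectral parameters. -/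
theorem IsSolution.hasDerivAt_wronskian (hQ : IsPotential Q) {u v : ℝ → Fin 2 → ℝ}
    (hu : IsSolution Q lam u) (hv : IsSolution Q mu v) (z : ℝ) :
    HasDerivAt (fun z => u z 0 * v z 1 - u z 1 * v z 0)
      ((mu - lam) * (u z 0 * v z 0 + u z 1 * v z 1)) z := by
  obtain ⟨hu0, hu1⟩ := (isSolution_iff hQ).mp hu z
  obtain ⟨hv0, hv1⟩ := (isSolution_iff hQ).mp hv z
  exact ((hu0.mul hv1).sub (hu1.mul hv0)).congr_deriv (by ring)

/-- Equal parameters give a constant Wronskian, hence determinant one; different parameters give the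
dependence on `lam`. -/
theorem IsSolution.wronskian_eq (hQ : IsPotential Q) {u v : ℝ → Fin 2 → ℝ}
    (hu : IsSolution Q lam u) (hv : IsSolution Q mu v) (z : ℝ) :
    u z 0 * v z 1 - u z 1 * v z 0 = u 0 0 * v 0 1 - u 0 1 * v 0 0 +
      (mu - lam) * ∫ t in (0 : ℝ)..z, (u t 0 * v t 0 + u t 1 * v t 1) := by
  have hc : Continuous fun t => u t 0 * v t 0 + u t 1 * v t 1 :=
    ((hu.continuous 0).mul (hv.continuous 0)).add ((hu.continuous 1).mul (hv.continuous 1))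
  have := intervalIntegral.integral_eq_sub_of_hasDerivAt (a := 0) (b := z)
    (fun t _ => hu.hasDerivAt_wronskian hQ hv t)
    ((hc.const_mul (mu - lam)).intervalIntegrable _ _)
  rw [intervalIntegral.integral_const_mul] at this
  linarith

/-- Solutions grow at most exponentially, at a rate independent of the spectral parameter. -/
theorem IsSolution.sq_add_sq_le (hQ : IsPotential Q) {C : ℝ} (hC : ∀ z i j, |Q z i j| ≤ C)
    {Y : ℝ → Fin 2 → ℝ} (hY : IsSolution Q lam Y) {z : ℝ} (hz : 0 ≤ z) :
    Y z 0 ^ 2 + Y z 1 ^ 2 ≤ exp (4 * C * z) * (Y 0 0 ^ 2 + Y 0 1 ^ 2) := by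
  -- The parameter enters through a skew matrix and cancels from the derivative of `|Y|²`; the rest
  -- is at most `4 C |Y|²`.
  have hder : ∀ t, HasDerivAt (fun t => exp (-(4 * C) * t) * (Y t 0 ^ 2 + Y t 1 ^ 2))
      (exp (-(4 * C) * t) * (2 * (Q t 0 1 * Y t 0 ^ 2 + (Q t 1 1 - Q t 0 0) * (Y t 0 * Y t 1)
        - Q t 0 1 * Y t 1 ^ 2) - 4 * C * (Y t 0 ^ 2 + Y t 1 ^ 2))) t := by
    intro t
    obtain ⟨h0, h1⟩ := (isSolution_iff hQ).mp hY t
    have h2 := ((hasDerivAt_id t).const_mul (-(4 * C))).exp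
    refine (h2.mul ((h0.pow 2).add (h1.pow 2))).congr_deriv ?_
    simp
    ring
  have hanti := antitone_of_hasDerivAt_nonpos hder (fun t => by
    refine mul_nonpos_of_nonneg_of_nonpos (exp_pos _).le ?_
    have h01 := abs_le.mp (hC t 0 1)
    have h00 := abs_le.mp (hC t 0 0)
    have h11 := abs_le.mp (hC t 1 1)
    have hb0 : Q t 0 1 * Y t 0 ^ 2 ≤ C * Y t 0 ^ 2 := by nlinarith [sq_nonneg (Y t 0)]
    have hb1 : -C * Y t 1 ^ 2 ≤ Q t 0 1 * Y t 1 ^ 2 := by nlinarith [sq_nonneg (Y t 1)]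
    have hb2 : (Q t 1 1 - Q t 0 0) * (Y t 0 * Y t 1) ≤ C * (Y t 0 ^ 2 + Y t 1 ^ 2) := by
      nlinarith [mul_nonneg (by linarith : 0 ≤ 2 * C - (Q t 1 1 - Q t 0 0))
        (sq_nonneg (Y t 0 + Y t 1)), mul_nonneg (by linarith : 0 ≤ 2 * C + (Q t 1 1 - Q t 0 0))
        (sq_nonneg (Y t 0 - Y t 1))]
    linarith)
  have h := hanti hz
  simp only [mul_zero, exp_zero, one_mul] at h
  have hE : exp (4 * C * z) * exp (-(4 * C) * z) = 1 := by
    rw [← exp_add, ← exp_zero]; congr 1; ring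
  calc _ = exp (4 * C * z) * (exp (-(4 * C) * z) * (Y z 0 ^ 2 + Y z 1 ^ 2)) := by
        rw [← mul_assoc, hE, one_mul]
    _ ≤ _ := mul_le_mul_of_nonneg_left h (exp_pos _).le

/-! ### Polar coordinates -/

/-- The quadratic form of `Q z` at the unit vector with angle `x`. -/
noncomputable def angleForm (Q : ℝ → Matrix (Fin 2) (Fin 2) ℝ) (z x : ℝ) : ℝ :=
  (Q z 0 0 + Q z 1 1) / 2 + (Q z 0 0 - Q z 1 1) / 2 * cos (2 * x) + Q z 0 1 * sin (2 * x)

theorem abs_angleForm_le {C : ℝ} (hC : ∀ z i j, |Q z i j| ≤ C) (z x : ℝ) :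
    |angleForm Q z x| ≤ 3 * C := by
  have h01 := hC z 0 1
  have h00 := abs_le.mp (hC z 0 0)
  have h11 := abs_le.mp (hC z 1 1)
  have hC0 : 0 ≤ C := (abs_nonneg _).trans h01
  have e1 : |(Q z 0 0 - Q z 1 1) / 2 * cos (2 * x)| ≤ C * 1 := by
    rw [abs_mul]
    exact mul_le_mul (abs_le.mpr ⟨by linarith, by linarith⟩) (abs_cos_le_one _) (abs_nonneg _) hC0
  have e2 : |Q z 0 1 * sin (2 * x)| ≤ C * 1 := by
    rw [abs_mul]
    exact mul_le_mul h01 (abs_sin_le_one _) (abs_nonneg _) hC0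
  have e1' := abs_le.mp e1
  have e2' := abs_le.mp e2
  rw [angleForm, abs_le]
  constructor <;> linarith

theorem lipschitzWith_angleForm {C : ℝ≥0} (hC : ∀ z i j, |Q z i j| ≤ C) (lam z : ℝ) :
    LipschitzWith (4 * C) fun x => lam - angleForm Q z x := by
  have hder : ∀ x, HasDerivAt (fun x => lam - angleForm Q z x)
      ((Q z 0 0 - Q z 1 1) * sin (2 * x) - 2 * Q z 0 1 * cos (2 * x)) x := by
    intro x
    have h2 : HasDerivAt (fun x : ℝ => 2 * x) 2 x := by
      simpa using (hasDerivAt_id x).const_mul 2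
    refine ((((h2.cos.const_mul ((Q z 0 0 - Q z 1 1) / 2)).const_add
      ((Q z 0 0 + Q z 1 1) / 2)).add (h2.sin.const_mul (Q z 0 1))).const_sub lam).congr_deriv ?_
    ring
  refine lipschitzWith_of_nnnorm_deriv_le (fun x => (hder x).differentiableAt) fun x => ?_
  rw [(hder x).deriv, ← NNReal.coe_le_coe, coe_nnnorm, Real.norm_eq_abs]
  have h01 := hC z 0 1
  have h00 := abs_le.mp (hC z 0 0)
  have h11 := abs_le.mp (hC z 1 1)
  have hC0 : (0 : ℝ) ≤ C := C.2
  have e1 : |(Q z 0 0 - Q z 1 1) * sin (2 * x)| ≤ 2 * C * 1 := by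
    rw [abs_mul]
    exact mul_le_mul (abs_le.mpr ⟨by linarith, by linarith⟩) (abs_sin_le_one _) (abs_nonneg _)
      (by linarith)
  have e2 : |2 * Q z 0 1 * cos (2 * x)| ≤ 2 * C * 1 := by
    rw [abs_mul, abs_mul, abs_two]
    exact mul_le_mul (by linarith) (abs_cos_le_one _) (abs_nonneg _) (by linarith)
  push_cast
  exact (abs_sub _ _).trans (by linarith)

theorem continuous_angleForm (hQ : IsPotential Q) {θ : ℝ → ℝ} (hθ : Continuous θ) :
    Continuous fun z => angleForm Q z (θ z) := by
  have := hQ.continuous 0 0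
  have := hQ.continuous 0 1
  have := hQ.continuous 1 1
  unfold angleForm
  fun_prop

theorem exists_hasDerivAt_angle (hQ : IsPotential Q) (lam γ : ℝ) :
    ∃ θ : ℝ → ℝ, θ 0 = γ ∧ ∀ z, HasDerivAt θ (lam - angleForm Q z (θ z)) z := by
  obtain ⟨C, hC0, hC⟩ := hQ.exists_bound
  lift C to ℝ≥0 using hC0
  refine exists_forall_hasDerivAt_of_bounded_of_lipschitz (K := 4 * C)
    (v := fun z x => lam - angleForm Q z x) (L := ‖lam‖₊ + 3 * C)
    (fun z => lipschitzWith_angleForm hC lam z)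
    (fun x => continuous_const.sub (continuous_angleForm hQ continuous_const)) (fun z x => ?_) γ
  push_cast
  exact (norm_sub_le _ _).trans (add_le_add_right (abs_angleForm_le hC z x) _)

/-- A solution of the angular equation gives a solution of the system. -/
theorem exists_isSolution_of_hasDerivAt_angle (hQ : IsPotential Q) {θ : ℝ → ℝ}
    (hθ : ∀ z, HasDerivAt θ (lam - angleForm Q z (θ z)) z) :
    ∃ R : ℝ → ℝ, R 0 = 1 ∧ (∀ z, 0 < R z) ∧
      IsSolution Q lam fun z => ![R z * cos (θ z), R z * sin (θ z)] := by
  have hθc : Continuous θ := continuous_iff_continuousAt.mpr fun t => (hθ t).continuousAt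
  have hg : Continuous fun z =>
      Q z 0 1 * cos (2 * θ z) + (Q z 1 1 - Q z 0 0) / 2 * sin (2 * θ z) := by
    have := hQ.continuous 0 0
    have := hQ.continuous 0 1
    have := hQ.continuous 1 1
    fun_prop
  -- This is the logarithmic derivative of the radius.
  set g := fun z => Q z 0 1 * cos (2 * θ z) + (Q z 1 1 - Q z 0 0) / 2 * sin (2 * θ z) with hgdef
  have hR : ∀ z, HasDerivAt (fun z => exp (∫ t in (0 : ℝ)..z, g t))
      (exp (∫ t in (0 : ℝ)..z, g t) * g z) z := fun z =>
    (intervalIntegral.integral_hasDerivAt_right (hg.intervalIntegrable _ _)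
      (hg.stronglyMeasurableAtFilter _ _) hg.continuousAt).exp
  refine ⟨fun z => exp (∫ t in (0 : ℝ)..z, g t), by simp, fun z => exp_pos _, ?_⟩
  refine (isSolution_iff hQ).mpr fun z => ?_
  have hs : sin (θ z) ^ 2 = 1 - cos (θ z) ^ 2 := sin_sq (θ z)
  constructor
  · refine ((hR z).mul (hθ z).cos).congr_deriv ?_
    simp only [hgdef, angleForm, cos_two_mul, sin_two_mul, Matrix.cons_val_zero,
      Matrix.cons_val_one]
    ring_nf
    simp only [hs]
    ring
  · refine ((hR z).mul (hθ z).sin).congr_deriv ?_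
    simp only [hgdef, angleForm, cos_two_mul, sin_two_mul, Matrix.cons_val_zero,
      Matrix.cons_val_one]
    ring_nf
    simp only [hs]
    ring

/-! ### The fundamental matrix -/

/-- Existence comes from the angle equation: initial angles `0` and `π / 2` give the two columns of
the identity. -/
theorem isFundamentalMatrix_fundamentalMatrix (hQ : IsPotential Q) (lam : ℝ) :
    IsFundamentalMatrix Q lam (fundamentalMatrix Q lam) := by
  refine Classical.epsilon_spec (p := IsFundamentalMatrix Q lam) ?_
  obtain ⟨θ, hθ0, hθ⟩ := exists_hasDerivAt_angle hQ lam 0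
  obtain ⟨φ, hφ0, hφ⟩ := exists_hasDerivAt_angle hQ lam (π / 2)
  obtain ⟨R, hR0, -, hR⟩ := exists_isSolution_of_hasDerivAt_angle hQ hθ
  obtain ⟨S, hS0, -, hS⟩ := exists_isSolution_of_hasDerivAt_angle hQ hφ
  refine ⟨fun z => !![R z * cos (θ z), S z * cos (φ z); R z * sin (θ z), S z * sin (φ z)], ?_, ?_⟩
  · ext i j
    fin_cases i <;> fin_cases j <;> simp [hθ0, hφ0, hR0, hS0]
  · intro j
    fin_cases j
    · convert! hR using 3 with z i
      fin_cases i <;> rfl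
    · convert! hS using 3 with z i
      fin_cases i <;> rfl

theorem fundamentalMatrix_zero (hQ : IsPotential Q) (lam : ℝ) : fundamentalMatrix Q lam 0 = 1 :=
  (isFundamentalMatrix_fundamentalMatrix hQ lam).1

theorem isSolution_fundamentalMatrix (hQ : IsPotential Q) (lam : ℝ) (j : Fin 2) :
    IsSolution Q lam fun z i => fundamentalMatrix Q lam z i j :=
  (isFundamentalMatrix_fundamentalMatrix hQ lam).2 j

theorem continuous_fundamentalMatrix (hQ : IsPotential Q) (lam : ℝ) (i j : Fin 2) :
    Continuous fun z => fundamentalMatrix Q lam z i j :=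
  (isSolution_fundamentalMatrix hQ lam j).continuous i

theorem fundamentalMatrix_det (hQ : IsPotential Q) (lam z : ℝ) :
    fundamentalMatrix Q lam z 0 0 * fundamentalMatrix Q lam z 1 1 -
      fundamentalMatrix Q lam z 1 0 * fundamentalMatrix Q lam z 0 1 = 1 := by
  have := (isSolution_fundamentalMatrix hQ lam 0).wronskian_eq hQ
    (isSolution_fundamentalMatrix hQ lam 1) z
  simpa [fundamentalMatrix_zero hQ] using this

/-- Variation of the spectral parameter. -/
theorem IsSolution.eq_fundamentalMatrix (hQ : IsPotential Q) {v : ℝ → Fin 2 → ℝ}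
    (hv : IsSolution Q mu v) (lam z : ℝ) (i : Fin 2) :
    v z i = fundamentalMatrix Q lam z i 0 * (v 0 0 - (mu - lam) * ∫ t in (0 : ℝ)..z,
        (fundamentalMatrix Q lam t 0 1 * v t 0 + fundamentalMatrix Q lam t 1 1 * v t 1)) +
      fundamentalMatrix Q lam z i 1 * (v 0 1 + (mu - lam) * ∫ t in (0 : ℝ)..z,
        (fundamentalMatrix Q lam t 0 0 * v t 0 + fundamentalMatrix Q lam t 1 0 * v t 1)) := by
  have h0 := (isSolution_fundamentalMatrix hQ lam 0).wronskian_eq hQ hv z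
  have h1 := (isSolution_fundamentalMatrix hQ lam 1).wronskian_eq hQ hv z
  have hdet := fundamentalMatrix_det hQ lam z
  simp only [fundamentalMatrix_zero hQ, Matrix.one_apply_eq, Matrix.one_apply_ne, ne_eq,
    zero_ne_one, one_ne_zero, not_false_eq_true, one_mul, zero_mul, sub_zero, zero_sub] at h0 h1
  -- Both brackets are, up to sign, Wronskians of a column with `v` at `z`; Cramer's rule with
  -- determinant one recovers `v z`.
  rw [← h0, show v 0 0 - (mu - lam) * ∫ t in (0 : ℝ)..z,
        (fundamentalMatrix Q lam t 0 1 * v t 0 + fundamentalMatrix Q lam t 1 1 * v t 1) =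
      -(fundamentalMatrix Q lam z 0 1 * v z 1 - fundamentalMatrix Q lam z 1 1 * v z 0) by
    rw [h1]; ring]
  fin_cases i
  · simp only [Fin.zero_eta]
    linear_combination -(v z 0) * hdet
  · simp only [Fin.mk_one]
    linear_combination -(v z 1) * hdet

/-- With equal parameters the integrals drop out. This serves as the uniqueness theorem for the
system. -/
theorem IsSolution.eq_fundamentalMatrix_mul (hQ : IsPotential Q) {v : ℝ → Fin 2 → ℝ}
    (hv : IsSolution Q lam v) (z : ℝ) (i : Fin 2) :
    v z i = fundamentalMatrix Q lam z i 0 * v 0 0 + fundamentalMatrix Q lam z i 1 * v 0 1 := by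
  simpa using hv.eq_fundamentalMatrix hQ lam z i

theorem exists_abs_fundamentalMatrix_le (hQ : IsPotential Q) :
    ∃ E : ℝ, 0 ≤ E ∧ ∀ lam, ∀ z ∈ Icc 0 π, ∀ i j, |fundamentalMatrix Q lam z i j| ≤ E := by
  obtain ⟨C, hC0, hC⟩ := hQ.exists_bound
  refine ⟨exp (4 * C * π), (exp_pos _).le, fun lam z hz i j => ?_⟩
  have h := (isSolution_fundamentalMatrix hQ lam j).sq_add_sq_le hQ hC hz.1
  have h0 : ∀ j, fundamentalMatrix Q lam 0 0 j ^ 2 + fundamentalMatrix Q lam 0 1 j ^ 2 = 1 := by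
    rw [fundamentalMatrix_zero hQ]
    simp [Fin.forall_fin_two]
  rw [h0 j, mul_one] at h
  have hE : exp (4 * C * z) ≤ exp (4 * C * π) := by gcongr; exact hz.2
  have hE1 : 1 ≤ exp (4 * C * π) := one_le_exp (by positivity)
  have hi : fundamentalMatrix Q lam z i j ^ 2 ≤ exp (4 * C * π) := by
    fin_cases i <;> simp only [Fin.zero_eta, Fin.mk_one]
    · linarith [sq_nonneg (fundamentalMatrix Q lam z 1 j)]
    · linarith [sq_nonneg (fundamentalMatrix Q lam z 0 j)]
  -- The exponential bounds the square of the entry and is at least `1`, hence at most its own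
  -- square.
  refine abs_le_of_sq_le_sq (hi.trans ?_) (exp_pos _).le
  nlinarith

/-! ### Dependence of the monodromy matrix on the spectral parameter -/

/-- The Gram matrix of the fundamental solutions on `[0, z]`, for two spectral parameters. -/
noncomputable def gram (Q : ℝ → Matrix (Fin 2) (Fin 2) ℝ) (lam mu z : ℝ) (k j : Fin 2) : ℝ :=
  ∫ t in (0 : ℝ)..z, (fundamentalMatrix Q lam t 0 k * fundamentalMatrix Q mu t 0 j +
    fundamentalMatrix Q lam t 1 k * fundamentalMatrix Q mu t 1 j)

/-- An exact difference quotient: bounded Gram entries give continuity in the parameter, and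
continuous Gram entries then give the derivative. -/
theorem fundamentalMatrix_sub (hQ : IsPotential Q) (lam mu z : ℝ) (i j : Fin 2) :
    fundamentalMatrix Q mu z i j - fundamentalMatrix Q lam z i j =
      (mu - lam) * (fundamentalMatrix Q lam z i 1 * gram Q lam mu z 0 j -
        fundamentalMatrix Q lam z i 0 * gram Q lam mu z 1 j) := by
  have h := (isSolution_fundamentalMatrix hQ mu j).eq_fundamentalMatrix hQ lam z i
  change _ = fundamentalMatrix Q lam z i 0 * (_ - (mu - lam) * gram Q lam mu z 1 j) +
    fundamentalMatrix Q lam z i 1 * (_ + (mu - lam) * gram Q lam mu z 0 j) at h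
  rw [fundamentalMatrix_zero hQ] at h
  have hj : fundamentalMatrix Q lam z i j = fundamentalMatrix Q lam z i 0 *
      (1 : Matrix (Fin 2) (Fin 2) ℝ) 0 j + fundamentalMatrix Q lam z i 1 *
      (1 : Matrix (Fin 2) (Fin 2) ℝ) 1 j := by
    revert j
    simp [Fin.forall_fin_two]
  rw [h, hj]
  ring

theorem continuousAt_fundamentalMatrix_param (hQ : IsPotential Q) (lam : ℝ) {z : ℝ}
    (hz : z ∈ Icc 0 π) (i j : Fin 2) :
    ContinuousAt (fun mu => fundamentalMatrix Q mu z i j) lam := by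
  obtain ⟨E, hE0, hE⟩ := exists_abs_fundamentalMatrix_le hQ
  have hG : ∀ mu k j, |gram Q lam mu z k j| ≤ (E * E + E * E) * |z - 0| := fun mu k j => by
    rw [← Real.norm_eq_abs]
    refine intervalIntegral.norm_integral_le_of_norm_le_const fun t ht => ?_
    rw [uIoc_of_le hz.1] at ht
    have ht' : t ∈ Icc 0 π := ⟨ht.1.le, ht.2.trans hz.2⟩
    refine (norm_add_le _ _).trans ?_
    rw [norm_mul, norm_mul]
    exact add_le_add
      (mul_le_mul (hE _ _ ht' _ _) (hE _ _ ht' _ _) (norm_nonneg _) hE0)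
      (mul_le_mul (hE _ _ ht' _ _) (hE _ _ ht' _ _) (norm_nonneg _) hE0)
  set B := (E * E + E * E) * |z - 0| with hB
  have hB0 : 0 ≤ B := by positivity
  have hlip : ∀ mu, |fundamentalMatrix Q mu z i j - fundamentalMatrix Q lam z i j| ≤
      |mu - lam| * (E * B + E * B) := fun mu => by
    rw [fundamentalMatrix_sub hQ, abs_mul]
    refine mul_le_mul_of_nonneg_left ((abs_sub _ _).trans ?_) (abs_nonneg _)
    rw [abs_mul, abs_mul]
    exact add_le_add
      (mul_le_mul (hE _ _ hz _ _) (hG _ _ _) (abs_nonneg _) hE0)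
      (mul_le_mul (hE _ _ hz _ _) (hG _ _ _) (abs_nonneg _) hE0)
  refine tendsto_iff_dist_tendsto_zero.mpr
    (squeeze_zero (fun _ => dist_nonneg) (fun mu => hlip mu) ?_)
  have : Continuous fun mu : ℝ => |mu - lam| * (E * B + E * B) := by fun_prop
  simpa using this.tendsto lam

theorem continuousAt_gram (hQ : IsPotential Q) (lam : ℝ) (k j : Fin 2) :
    ContinuousAt (fun mu => gram Q lam mu π k j) lam := by
  obtain ⟨E, hE0, hE⟩ := exists_abs_fundamentalMatrix_le hQ
  refine intervalIntegral.continuousAt_of_dominated_interval (bound := fun _ => E * E + E * E)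
    (.of_forall fun mu => ?_) (.of_forall fun mu => .of_forall fun t ht => ?_)
    intervalIntegrable_const (.of_forall fun t ht => ?_)
  · refine (Continuous.aestronglyMeasurable ?_)
    exact ((continuous_fundamentalMatrix hQ _ _ _).mul (continuous_fundamentalMatrix hQ _ _ _)).add
      ((continuous_fundamentalMatrix hQ _ _ _).mul (continuous_fundamentalMatrix hQ _ _ _))
  · rw [uIoc_of_le pi_pos.le] at ht
    have ht' := Ioc_subset_Icc_self ht
    refine (norm_add_le _ _).trans ?_
    rw [norm_mul, norm_mul]
    exact add_le_add
      (mul_le_mul (hE _ _ ht' _ _) (hE _ _ ht' _ _) (norm_nonneg _) hE0)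
      (mul_le_mul (hE _ _ ht' _ _) (hE _ _ ht' _ _) (norm_nonneg _) hE0)
  · rw [uIoc_of_le pi_pos.le] at ht
    have ht' := Ioc_subset_Icc_self ht
    exact (continuousAt_const.mul (continuousAt_fundamentalMatrix_param hQ lam ht' _ _)).add
      (continuousAt_const.mul (continuousAt_fundamentalMatrix_param hQ lam ht' _ _))

theorem hasDerivAt_fundamentalMatrix_param (hQ : IsPotential Q) (lam : ℝ) (i j : Fin 2) :
    HasDerivAt (fun mu => fundamentalMatrix Q mu π i j)
      (fundamentalMatrix Q lam π i 1 * gram Q lam lam π 0 j -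
        fundamentalMatrix Q lam π i 0 * gram Q lam lam π 1 j) lam := by
  rw [hasDerivAt_iff_tendsto_slope]
  have hc : ContinuousAt (fun mu => fundamentalMatrix Q lam π i 1 * gram Q lam mu π 0 j -
      fundamentalMatrix Q lam π i 0 * gram Q lam mu π 1 j) lam :=
    (continuousAt_const.mul (continuousAt_gram hQ lam _ _)).sub
      (continuousAt_const.mul (continuousAt_gram hQ lam _ _))
  refine (hc.tendsto.mono_left nhdsWithin_le_nhds).congr' ?_
  filter_upwards [self_mem_nhdsWithin] with mu hmu
  have : mu - lam ≠ 0 := sub_ne_zero.mpr hmu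
  rw [slope_def_field, fundamentalMatrix_sub hQ lam mu]
  field_simp

theorem discriminant_eq (Q : ℝ → Matrix (Fin 2) (Fin 2) ℝ) (lam : ℝ) :
    discriminant Q lam = fundamentalMatrix Q lam π 0 0 + fundamentalMatrix Q lam π 1 1 := by
  rw [discriminant, Matrix.trace_fin_two]

/-- The integrand is one quadratic form, with coefficients from the monodromy matrix, summed over
the two rows of the fundamental matrix at `t`. -/
theorem hasDerivAt_discriminant (hQ : IsPotential Q) (lam : ℝ) :
    HasDerivAt (discriminant Q)
      (-∫ t in (0 : ℝ)..π,
        (fundamentalMatrix Q lam π 1 0 *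
          (fundamentalMatrix Q lam t 0 1 ^ 2 + fundamentalMatrix Q lam t 1 1 ^ 2) +
        (fundamentalMatrix Q lam π 0 0 - fundamentalMatrix Q lam π 1 1) *
          (fundamentalMatrix Q lam t 0 0 * fundamentalMatrix Q lam t 0 1 +
            fundamentalMatrix Q lam t 1 0 * fundamentalMatrix Q lam t 1 1) -
        fundamentalMatrix Q lam π 0 1 *
          (fundamentalMatrix Q lam t 0 0 ^ 2 + fundamentalMatrix Q lam t 1 0 ^ 2))) lam := by
  have h := (hasDerivAt_fundamentalMatrix_param hQ lam 0 0).add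
    (hasDerivAt_fundamentalMatrix_param hQ lam 1 1)
  have he : discriminant Q = (fun mu => fundamentalMatrix Q mu π 0 0) +
      fun mu => fundamentalMatrix Q mu π 1 1 := by
    ext mu; exact discriminant_eq Q mu
  rw [he]
  refine h.congr_deriv ?_
  have c00 := continuous_fundamentalMatrix hQ lam 0 0
  have c01 := continuous_fundamentalMatrix hQ lam 0 1
  have c10 := continuous_fundamentalMatrix hQ lam 1 0
  have c11 := continuous_fundamentalMatrix hQ lam 1 1
  simp only [gram]
  simp only [← intervalIntegral.integral_const_mul]
  rw [← intervalIntegral.integral_sub, ← intervalIntegral.integral_sub,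
    ← intervalIntegral.integral_add, ← intervalIntegral.integral_neg]
  · congr 1; ext t; ring
  all_goals exact (by fun_prop : Continuous _).intervalIntegrable _ _

end CanonicalSystem

namespace CanonicalSystem

variable {Q : ℝ → Matrix (Fin 2) (Fin 2) ℝ} {lam : ℝ}

/-! ### The angular part -/

/-- By the intermediate value theorem, a continuous function leaving `0` for another multiple of
`2π` would pass `π` or `-π`, where the cosine is `-1`. -/
theorem eq_zero_of_cos_eq_one {φ : ℝ → ℝ} (hφ : Continuous φ) (h0 : φ 0 = 0)
    (hcos : ∀ z, cos (φ z) = 1) (z : ℝ) : φ z = 0 := by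
  by_contra hne
  have hπ := pi_pos
  have himg := intermediate_value_uIcc (a := 0) (b := z) hφ.continuousOn
  rw [h0] at himg
  obtain ⟨n, hn⟩ := (cos_eq_one_iff _).mp (hcos z)
  suffices h : π ∈ uIcc 0 (φ z) ∨ -π ∈ uIcc 0 (φ z) by
    rcases h with h | h
    · obtain ⟨t, -, ht⟩ := himg h
      have := hcos t
      rw [ht, cos_pi] at this
      norm_num at this
    · obtain ⟨t, -, ht⟩ := himg h
      have := hcos t
      rw [ht, cos_neg, cos_pi] at this
      norm_num at this
  have hn0 : n ≠ 0 := by rintro rfl; simp at hn; exact hne hn.symm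
  rcases lt_or_gt_of_ne hn0 with hn' | hn'
  · right
    have : (n : ℝ) ≤ -1 := by exact_mod_cast (by omega : n ≤ -1)
    rw [mem_uIcc]
    right
    constructor <;> nlinarith
  · left
    have : (1 : ℝ) ≤ n := by exact_mod_cast (by omega : 1 ≤ n)
    rw [mem_uIcc]
    left
    constructor <;> nlinarith

theorem isAngularPart_angularPart (hQ : IsPotential Q) (lam γ : ℝ) :
    IsAngularPart Q lam γ (angularPart Q lam γ) := by
  refine Classical.epsilon_spec (p := IsAngularPart Q lam γ) ?_
  obtain ⟨θ, hθ0, hθ⟩ := exists_hasDerivAt_angle hQ lam γ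
  obtain ⟨R, hR0, hRpos, hR⟩ := exists_isSolution_of_hasDerivAt_angle hQ hθ
  exact ⟨θ, continuous_iff_continuousAt.mpr fun t => (hθ t).continuousAt, hθ0, _, R, hR,
    by simp [hR0, hθ0], fun z => ⟨hRpos z, rfl⟩⟩

theorem angularPart_zero (hQ : IsPotential Q) (lam γ : ℝ) : angularPart Q lam γ 0 = γ :=
  (isAngularPart_angularPart hQ lam γ).2.1

/-- The chosen angle and the solution of the angle equation describe the same solution of the
system, so the radii agree and the angles differ by a continuous function with cosine `1`, vanishing
at `0`. -/
theorem hasDerivAt_angularPart (hQ : IsPotential Q) (lam γ z : ℝ) :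
    HasDerivAt (angularPart Q lam γ) (lam - angleForm Q z (angularPart Q lam γ z)) z := by
  obtain ⟨hc, h0, Ψ, R, hΨ, hΨ0, hR⟩ := isAngularPart_angularPart hQ lam γ
  obtain ⟨θ, hθ0, hθ⟩ := exists_hasDerivAt_angle hQ lam γ
  obtain ⟨S, hS0, hSpos, hS⟩ := exists_isSolution_of_hasDerivAt_angle hQ hθ
  have hθc : Continuous θ := continuous_iff_continuousAt.mpr fun t => (hθ t).continuousAt
  have heq : ∀ z i, Ψ z i = (![S z * cos (θ z), S z * sin (θ z)] : Fin 2 → ℝ) i := fun z i => by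
    rw [hΨ.eq_fundamentalMatrix_mul hQ, hS.eq_fundamentalMatrix_mul hQ, hΨ0]
    simp [hS0, hθ0]
  have hcos : ∀ z, cos (angularPart Q lam γ z - θ z) = 1 := fun z => by
    have e0 := heq z 0
    have e1 := heq z 1
    rw [(hR z).2] at e0 e1
    simp only [Matrix.cons_val_zero, Matrix.cons_val_one] at e0 e1
    have hRS : R z ^ 2 = S z ^ 2 := by
      linear_combination -(R z ^ 2) * sin_sq_add_cos_sq (angularPart Q lam γ z) +
        S z ^ 2 * sin_sq_add_cos_sq (θ z) +
        (R z * cos (angularPart Q lam γ z) + S z * cos (θ z)) * e0 +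
        (R z * sin (angularPart Q lam γ z) + S z * sin (θ z)) * e1
    have hRS' : R z = S z := by
      rcases sq_eq_sq_iff_eq_or_eq_neg.mp hRS with h | h
      · exact h
      · linarith [(hR z).1, hSpos z]
    rw [hRS'] at e0 e1
    have e0' := mul_left_cancel₀ (hSpos z).ne' e0
    have e1' := mul_left_cancel₀ (hSpos z).ne' e1
    rw [cos_sub, e0', e1', ← sq, ← sq, cos_sq_add_sin_sq]
  have hfun : angularPart Q lam γ = θ := funext fun z =>
    sub_eq_zero.mp (eq_zero_of_cos_eq_one (hc.sub hθc) (by simp [h0, hθ0]) hcos z)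
  rw [hfun]
  exact hθ z

theorem continuous_angularPart (hQ : IsPotential Q) (lam γ : ℝ) :
    Continuous (angularPart Q lam γ) :=
  (isAngularPart_angularPart hQ lam γ).1

/-- The first column of the fundamental matrix in polar coordinates. -/
theorem exists_fundamentalMatrix_eq_polar (hQ : IsPotential Q) (lam z : ℝ) :
    ∃ R > 0, fundamentalMatrix Q lam z 0 0 = R * cos (angularPart Q lam 0 z) ∧
      fundamentalMatrix Q lam z 1 0 = R * sin (angularPart Q lam 0 z) := by
  obtain ⟨hc, h0, Ψ, R, hΨ, hΨ0, hR⟩ := isAngularPart_angularPart hQ lam 0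
  have h : ∀ i, Ψ z i = fundamentalMatrix Q lam z i 0 := fun i => by
    rw [hΨ.eq_fundamentalMatrix_mul hQ, hΨ0]
    simp
  exact ⟨R z, (hR z).1, by rw [← h, (hR z).2]; rfl, by rw [← h, (hR z).2]; rfl⟩

/-- Where the angles for `lam < mu` meet, their difference has derivative `lam - mu < 0`. -/
theorem strictMono_angularPart (hQ : IsPotential Q) (γ : ℝ) :
    StrictMono fun lam => angularPart Q lam γ π := by
  intro lam mu hlm
  have h := lt_of_deriv_neg_of_eq pi_pos (B := 0)
    (fun t _ => (hasDerivAt_angularPart hQ lam γ t).sub (hasDerivAt_angularPart hQ mu γ t))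
    (by simp [angularPart_zero hQ]) (fun t _ ht => by
      have : angularPart Q lam γ t = angularPart Q mu γ t := sub_eq_zero.mp ht
      rw [this]
      linarith)
  simpa using h

/-- Grönwall: the angle for `lam` solves the equation for `mu` up to the error `|lam - mu|`. -/
theorem continuous_angularPart_param (hQ : IsPotential Q) (γ : ℝ) :
    Continuous fun lam => angularPart Q lam γ π := by
  obtain ⟨C, hC0, hC⟩ := hQ.exists_bound
  lift C to ℝ≥0 using hC0
  refine continuous_iff_continuousAt.mpr fun mu => ?_
  have hle : ∀ lam, dist (angularPart Q lam γ π) (angularPart Q mu γ π) ≤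
      gronwallBound 0 (4 * C : ℝ≥0) |lam - mu| π := fun lam => by
    have := dist_le_of_approx_trajectories_ODE (v := fun z x => mu - angleForm Q z x)
      (K := 4 * C) (a := 0) (b := π) (εf := |lam - mu|) (εg := 0) (δ := 0)
      (fun z => lipschitzWith_angleForm hC mu z)
      (continuous_angularPart hQ lam γ).continuousOn
      (fun t _ => (hasDerivAt_angularPart hQ lam γ t).hasDerivWithinAt)
      (fun t _ => by simp [Real.dist_eq])
      (continuous_angularPart hQ mu γ).continuousOn
      (fun t _ => (hasDerivAt_angularPart hQ mu γ t).hasDerivWithinAt)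
      (fun t _ => by simp) (by simp [angularPart_zero hQ]) π ⟨pi_pos.le, le_rfl⟩
    simpa using this
  refine tendsto_iff_dist_tendsto_zero.mpr (squeeze_zero (fun _ => dist_nonneg) hle ?_)
  have hc : Continuous fun lam => gronwallBound 0 (4 * C : ℝ≥0) |lam - mu| π :=
    (gronwallBound_continuous_ε 0 _ π).comp (by fun_prop)
  have := hc.tendsto mu
  rwa [sub_self, abs_zero, gronwallBound_ε0_δ0] at this

theorem angularPart_pi_eq (hQ : IsPotential Q) (lam γ : ℝ) :
    angularPart Q lam γ π =
      γ + lam * π - ∫ t in (0 : ℝ)..π, angleForm Q t (angularPart Q lam γ t) := by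
  have hc := continuous_angleForm hQ (continuous_angularPart hQ lam γ)
  have h := intervalIntegral.integral_eq_sub_of_hasDerivAt (a := 0) (b := π)
    (fun t _ => hasDerivAt_angularPart hQ lam γ t)
    ((continuous_const.sub hc).intervalIntegrable _ _)
  rw [intervalIntegral.integral_sub intervalIntegrable_const (hc.intervalIntegrable _ _),
    intervalIntegral.integral_const, angularPart_zero hQ, smul_eq_mul] at h
  linarith

theorem abs_angularPart_sub_le (hQ : IsPotential Q) {C : ℝ} (hC : ∀ z i j, |Q z i j| ≤ C)
    (lam γ : ℝ) : |angularPart Q lam γ π - γ - lam * π| ≤ 3 * C * π := by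
  have h := intervalIntegral.norm_integral_le_of_norm_le_const (a := 0) (b := π)
    (f := fun t => angleForm Q t (angularPart Q lam γ t)) (C := 3 * C)
    (fun t _ => abs_angleForm_le hC t _)
  rw [sub_zero, abs_of_pos pi_pos, Real.norm_eq_abs] at h
  rw [angularPart_pi_eq hQ, ← abs_neg]
  convert! h using 2
  ring

/-! ### The eigenvalues `μ_n` -/

theorem angularPart_mu (hQ : IsPotential Q) (n : ℤ) : angularPart Q (mu Q n) 0 π = n * π := by
  refine Classical.epsilon_spec (p := fun m : ℝ => angularPart Q m 0 π = n * π) ?_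
  obtain ⟨C, hC0, hC⟩ := hQ.exists_bound
  have hb := fun lam => abs_le.mp (abs_angularPart_sub_le hQ hC lam 0)
  -- The angle at `π` differs from `lam * π` by at most `3 * C * π`, so shifts of `n` by `3 * C`
  -- bracket the value.
  refine mem_range_of_exists_le_of_exists_ge (continuous_angularPart_param hQ 0)
    ⟨n - 3 * C, ?_⟩ ⟨n + 3 * C, ?_⟩
  · linarith [(hb (n - 3 * C)).2]
  · linarith [(hb (n + 3 * C)).1]

theorem strictMono_mu (hQ : IsPotential Q) : StrictMono (mu Q) := by
  intro m n hmn
  refine (strictMono_angularPart hQ 0).lt_iff_lt.mp ?_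
  rw [angularPart_mu hQ, angularPart_mu hQ]
  have : (m : ℝ) < n := by exact_mod_cast hmn
  exact mul_lt_mul_of_pos_right this pi_pos

/-- `angleForm` is half the trace plus terms in `cos (2θ)` and `sin (2θ)`; both oscillate away, with
phases `α = 0` and `α = π / 2`. -/
theorem exists_abs_angularPart_sub_le (hQ : IsPotential Q) {ε : ℝ} (hε : 0 < ε) :
    ∃ Λ : ℝ, ∀ lam : ℝ, Λ ≤ |lam| → |angularPart Q lam 0 π -
      (lam * π - ∫ t in (0 : ℝ)..π, (Q t).trace / 2)| ≤ ε := by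
  obtain ⟨C, hC0, hC⟩ := hQ.exists_bound
  have c00 := hQ.continuous 0 0
  have c01 := hQ.continuous 0 1
  have c11 := hQ.continuous 1 1
  have cq : Continuous fun z => (Q z 0 0 - Q z 1 1) / 2 := by fun_prop
  obtain ⟨Λ₁, h₁⟩ := exists_abs_integral_mul_cos_le cq (3 * C) 0 (half_pos hε)
  obtain ⟨Λ₂, h₂⟩ := exists_abs_integral_mul_cos_le c01 (3 * C) (π / 2) (half_pos hε)
  refine ⟨max Λ₁ Λ₂, fun lam hlam => ?_⟩
  have hθc := continuous_angularPart hQ lam 0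
  have hf := continuous_angleForm hQ hθc
  have hd := hasDerivAt_angularPart hQ lam 0
  have hb : ∀ t, |angleForm Q t (angularPart Q lam 0 t)| ≤ 3 * C := fun t => abs_angleForm_le hC t _
  have i₁ := h₁ lam _ _ ((le_max_left _ _).trans hlam) hf hd hb
  have i₂ := h₂ lam _ _ ((le_max_right _ _).trans hlam) hf hd hb
  simp only [sub_zero, cos_sub_pi_div_two] at i₁ i₂
  have e : (∫ t in (0 : ℝ)..π, angleForm Q t (angularPart Q lam 0 t)) =
      (∫ t in (0 : ℝ)..π, (Q t).trace / 2) +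
      (∫ t in (0 : ℝ)..π, (Q t 0 0 - Q t 1 1) / 2 * cos (2 * angularPart Q lam 0 t)) +
      ∫ t in (0 : ℝ)..π, Q t 0 1 * sin (2 * angularPart Q lam 0 t) := by
    simp only [Matrix.trace_fin_two]
    rw [← intervalIntegral.integral_add, ← intervalIntegral.integral_add]
    · rfl
    all_goals exact (by fun_prop : Continuous _).intervalIntegrable _ _
  rw [angularPart_pi_eq hQ, e, ← abs_neg]
  calc _ = |(∫ t in (0 : ℝ)..π, (Q t 0 0 - Q t 1 1) / 2 * cos (2 * angularPart Q lam 0 t)) +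
      ∫ t in (0 : ℝ)..π, Q t 0 1 * sin (2 * angularPart Q lam 0 t)| := by congr 1; ring
    _ ≤ _ := (abs_add_le _ _).trans (by linarith)

/-- `μ_n - n` tends to the mean value of half the trace of `Q` as `|n| → ∞`. -/
theorem exists_abs_mu_sub_le (hQ : IsPotential Q) {ε : ℝ} (hε : 0 < ε) :
    ∃ N : ℝ, ∀ n : ℤ, N ≤ |(n : ℝ)| →
      |mu Q n - n - 1 / π * ∫ t in (0 : ℝ)..π, (Q t).trace / 2| ≤ ε := by
  have hπ := pi_pos
  obtain ⟨C, hC0, hC⟩ := hQ.exists_bound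
  obtain ⟨Λ, hΛ⟩ := exists_abs_angularPart_sub_le hQ (mul_pos hε hπ)
  refine ⟨Λ + 3 * C, fun n hn => ?_⟩
  have h₁ := abs_angularPart_sub_le hQ hC (mu Q n) 0
  rw [angularPart_mu hQ, sub_zero, ← sub_mul, abs_mul, abs_of_pos hπ] at h₁
  have h₂ := le_of_mul_le_mul_right h₁ hπ
  have h₃ : Λ ≤ |mu Q n| := by
    have := abs_sub_abs_le_abs_sub (n : ℝ) (mu Q n)
    linarith
  have h₄ := hΛ (mu Q n) h₃
  rw [angularPart_mu hQ] at h₄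
  refine le_of_mul_le_mul_right ?_ hπ
  calc _ = |(mu Q n - n - 1 / π * ∫ t in (0 : ℝ)..π, (Q t).trace / 2) * π| := by
        rw [abs_mul, abs_of_pos hπ]
    _ = |n * π - (mu Q n * π - ∫ t in (0 : ℝ)..π, (Q t).trace / 2)| := by
        rw [← abs_neg]; congr 1; field_simp; ring
    _ ≤ _ := h₄

end CanonicalSystem

namespace CanonicalSystem

variable {Q : ℝ → Matrix (Fin 2) (Fin 2) ℝ} {lam ε : ℝ}

/-! ### The derivative of the discriminant -/

section Quadratic

variable {b c e s x₀ x₁ y₀ y₁ : ℝ}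

/-- Completing the square leaves nonnegative terms. If the squares vanished for both rows, the
columns would be dependent, against determinant one. -/
theorem quadratic_sum_pos (hc : 0 < c) (hs : 0 ≤ -4 * b * c - e ^ 2)
    (hdet : x₀ * y₁ - y₀ * x₁ = 1) :
    0 < c * (x₁ ^ 2 + y₁ ^ 2) + e * (x₀ * x₁ + y₀ * y₁) - b * (x₀ ^ 2 + y₀ ^ 2) := by
  have key : 4 * c * (c * (x₁ ^ 2 + y₁ ^ 2) + e * (x₀ * x₁ + y₀ * y₁) - b * (x₀ ^ 2 + y₀ ^ 2)) =
      (2 * c * x₁ + e * x₀) ^ 2 + (2 * c * y₁ + e * y₀) ^ 2 +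
        (-4 * b * c - e ^ 2) * (x₀ ^ 2 + y₀ ^ 2) := by ring
  have hpos : 0 < (2 * c * x₁ + e * x₀) ^ 2 + (2 * c * y₁ + e * y₀) ^ 2 := by
    by_contra! hle
    have h₁ : 2 * c * x₁ + e * x₀ = 0 := by
      nlinarith [sq_nonneg (2 * c * x₁ + e * x₀), sq_nonneg (2 * c * y₁ + e * y₀)]
    have h₂ : 2 * c * y₁ + e * y₀ = 0 := by
      nlinarith [sq_nonneg (2 * c * x₁ + e * x₀), sq_nonneg (2 * c * y₁ + e * y₀)]
    have : 2 * c = 0 := by linear_combination x₀ * h₂ - y₀ * h₁ - 2 * c * hdet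
    linarith
  have : 0 ≤ (-4 * b * c - e ^ 2) * (x₀ ^ 2 + y₀ ^ 2) := by positivity
  exact pos_of_mul_pos_right (by linarith : 0 < 4 * c * _) (by positivity)

/-- For the symmetric matrix `A` of the form and `M` of determinant one, `tr (M A Mᵀ) ≥ 2 √(det A)`;
the identity `key` is `tr² = 4 det + (difference of diagonal entries)² + (2 · off-diagonal)²`. -/
theorem le_quadratic_sum (hc : 0 < c) (hs : s ^ 2 = -4 * b * c - e ^ 2)
    (hdet : x₀ * y₁ - y₀ * x₁ = 1) :
    s ≤ c * (x₁ ^ 2 + y₁ ^ 2) + e * (x₀ * x₁ + y₀ * y₁) - b * (x₀ ^ 2 + y₀ ^ 2) := by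
  have hpos := quadratic_sum_pos hc (hs ▸ sq_nonneg s) hdet
  refine le_of_sq_le_sq ?_ hpos.le
  have key : (c * (x₁ ^ 2 + y₁ ^ 2) + e * (x₀ * x₁ + y₀ * y₁) - b * (x₀ ^ 2 + y₀ ^ 2)) ^ 2 =
      (-4 * b * c - e ^ 2) * (x₀ * y₁ - y₀ * x₁) ^ 2 +
      ((c * x₁ ^ 2 + e * (x₀ * x₁) - b * x₀ ^ 2) - (c * y₁ ^ 2 + e * (y₀ * y₁) - b * y₀ ^ 2)) ^ 2 +
      (2 * c * x₁ * y₁ + e * (x₀ * y₁ + x₁ * y₀) - 2 * b * x₀ * y₀) ^ 2 := by ring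
  rw [key, hdet, hs]
  nlinarith [sq_nonneg ((c * x₁ ^ 2 + e * (x₀ * x₁) - b * x₀ ^ 2) -
    (c * y₁ ^ 2 + e * (y₀ * y₁) - b * y₀ ^ 2)),
    sq_nonneg (2 * c * x₁ * y₁ + e * (x₀ * y₁ + x₁ * y₀) - 2 * b * x₀ * y₀)]

end Quadratic

/-- The integrand of `-ε Δ'`. -/
noncomputable def discriminantDensity (Q : ℝ → Matrix (Fin 2) (Fin 2) ℝ) (lam ε t : ℝ) : ℝ :=
  ε * fundamentalMatrix Q lam π 1 0 *
    (fundamentalMatrix Q lam t 0 1 ^ 2 + fundamentalMatrix Q lam t 1 1 ^ 2) +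
  ε * (fundamentalMatrix Q lam π 0 0 - fundamentalMatrix Q lam π 1 1) *
    (fundamentalMatrix Q lam t 0 0 * fundamentalMatrix Q lam t 0 1 +
      fundamentalMatrix Q lam t 1 0 * fundamentalMatrix Q lam t 1 1) -
  ε * fundamentalMatrix Q lam π 0 1 *
    (fundamentalMatrix Q lam t 0 0 ^ 2 + fundamentalMatrix Q lam t 1 0 ^ 2)

theorem continuous_discriminantDensity (hQ : IsPotential Q) (lam ε : ℝ) :
    Continuous (discriminantDensity Q lam ε) := by
  have c00 := continuous_fundamentalMatrix hQ lam 0 0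
  have c01 := continuous_fundamentalMatrix hQ lam 0 1
  have c10 := continuous_fundamentalMatrix hQ lam 1 0
  have c11 := continuous_fundamentalMatrix hQ lam 1 1
  unfold discriminantDensity
  fun_prop

theorem hasDerivAt_mul_discriminant (hQ : IsPotential Q) (lam ε : ℝ) :
    HasDerivAt (fun x => ε * discriminant Q x)
      (-∫ t in (0 : ℝ)..π, discriminantDensity Q lam ε t) lam := by
  refine ((hasDerivAt_discriminant hQ lam).const_mul ε).congr_deriv ?_
  rw [mul_neg, ← intervalIntegral.integral_const_mul]
  congr 2
  ext t
  rw [discriminantDensity]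
  ring

theorem four_sub_sq_discriminant (hQ : IsPotential Q) (lam : ℝ) (hε : ε ^ 2 = 1) :
    4 - (ε * discriminant Q lam) ^ 2 =
      -4 * (ε * fundamentalMatrix Q lam π 0 1) * (ε * fundamentalMatrix Q lam π 1 0) -
      (ε * (fundamentalMatrix Q lam π 0 0 - fundamentalMatrix Q lam π 1 1)) ^ 2 := by
  have h := fundamentalMatrix_det hQ lam π
  rw [discriminant_eq]
  linear_combination (-4 * ε ^ 2) * h - 4 * hε

theorem discriminantDensity_pos (hQ : IsPotential Q) (hε : ε ^ 2 = 1)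
    (hpos : 0 < ε * fundamentalMatrix Q lam π 1 0) (hΔ : (ε * discriminant Q lam) ^ 2 ≤ 4) (t : ℝ) :
    0 < discriminantDensity Q lam ε t :=
  quadratic_sum_pos hpos (by rw [← four_sub_sq_discriminant hQ lam hε]; linarith)
    (fundamentalMatrix_det hQ lam t)

theorem integral_discriminantDensity_pos (hQ : IsPotential Q) (hε : ε ^ 2 = 1)
    (hpos : 0 < ε * fundamentalMatrix Q lam π 1 0) (hΔ : (ε * discriminant Q lam) ^ 2 ≤ 4) :
    0 < ∫ t in (0 : ℝ)..π, discriminantDensity Q lam ε t :=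
  intervalIntegral.intervalIntegral_pos_of_pos
    ((continuous_discriminantDensity hQ lam ε).intervalIntegrable _ _)
    (discriminantDensity_pos hQ hε hpos hΔ) pi_pos

theorem sqrt_le_discriminantDensity (hQ : IsPotential Q) (hε : ε ^ 2 = 1)
    (hpos : 0 < ε * fundamentalMatrix Q lam π 1 0) (hΔ : (ε * discriminant Q lam) ^ 2 ≤ 4) (t : ℝ) :
    √(4 - (ε * discriminant Q lam) ^ 2) ≤ discriminantDensity Q lam ε t :=
  le_quadratic_sum hpos (by rw [sq_sqrt (by linarith), four_sub_sq_discriminant hQ lam hε])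
    (fundamentalMatrix_det hQ lam t)

theorem pi_mul_sqrt_le_integral (hQ : IsPotential Q) (hε : ε ^ 2 = 1)
    (hpos : 0 < ε * fundamentalMatrix Q lam π 1 0) (hΔ : (ε * discriminant Q lam) ^ 2 ≤ 4) :
    π * √(4 - (ε * discriminant Q lam) ^ 2) ≤
      ∫ t in (0 : ℝ)..π, discriminantDensity Q lam ε t := by
  have h := intervalIntegral.integral_mono_on (a := 0) (b := π) pi_pos.le
    (intervalIntegrable_const (c := √(4 - (ε * discriminant Q lam) ^ 2)) (μ := volume))
    ((continuous_discriminantDensity hQ lam ε).intervalIntegrable _ _)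
    (fun t _ => sqrt_le_discriminantDensity hQ hε hpos hΔ t)
  rwa [intervalIntegral.integral_const, sub_zero, smul_eq_mul] at h

/-! ### Rigidity in the case of equality -/

/-- Equality in the lower bound for `|Δ'|` forces the fundamental matrix to be a rotation. -/
theorem fundamentalMatrix_rotation_of_integral_le (hQ : IsPotential Q) (hε : ε ^ 2 = 1)
    (hpos : 0 < ε * fundamentalMatrix Q lam π 1 0) (hΔ : (ε * discriminant Q lam) ^ 2 ≤ 4)
    (hle : (∫ t in (0 : ℝ)..π, discriminantDensity Q lam ε t) ≤
      π * √(4 - (ε * discriminant Q lam) ^ 2)) :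
    ∀ t ∈ Icc 0 π, fundamentalMatrix Q lam t 0 0 = fundamentalMatrix Q lam t 1 1 ∧
      fundamentalMatrix Q lam t 1 0 = -fundamentalMatrix Q lam t 0 1 := by
  set s := √(4 - (ε * discriminant Q lam) ^ 2) with hs
  have hc := continuous_discriminantDensity hQ lam ε
  have heq : ∀ t ∈ Icc 0 π, discriminantDensity Q lam ε t = s := by
    by_contra! hne
    obtain ⟨t, ht, hne⟩ := hne
    have hlow := sqrt_le_discriminantDensity hQ hε hpos hΔ
    have := intervalIntegral.integral_pos pi_pos (f := fun t => discriminantDensity Q lam ε t - s)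
      (hc.sub continuous_const).continuousOn (fun t _ => sub_nonneg.mpr (hlow t))
      ⟨t, ht, sub_pos.mpr (lt_of_le_of_ne (hlow t) hne.symm)⟩
    rw [intervalIntegral.integral_sub (hc.intervalIntegrable _ _) intervalIntegrable_const,
      intervalIntegral.integral_const, sub_zero, smul_eq_mul] at this
    linarith
  have hs2 : s ^ 2 = _ := (sq_sqrt (by linarith)).trans (four_sub_sq_discriminant hQ lam hε)
  -- At `t = 0` the density is `c - b`; equating it with `s` and using `s² = -4bc - e²` gives `(c +
  -- b)² + e² = 0`.
  have h0 := heq 0 ⟨le_rfl, pi_pos.le⟩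
  rw [discriminantDensity, fundamentalMatrix_zero hQ] at h0
  simp only [Matrix.one_apply_eq, Matrix.one_apply_ne, ne_eq, zero_ne_one, one_ne_zero,
    not_false_eq_true, one_pow, mul_zero, mul_one, add_zero, zero_add, OfNat.ofNat_ne_zero,
    zero_pow] at h0
  have hdisc := fun t (ht : t ∈ Icc 0 π) => heq t ht
  simp only [discriminantDensity] at hdisc
  generalize ε * fundamentalMatrix Q lam π 1 0 = c at *
  generalize ε * fundamentalMatrix Q lam π 0 1 = b at *
  generalize ε * (fundamentalMatrix Q lam π 0 0 - fundamentalMatrix Q lam π 1 1) = e at *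
  have hsq : (c + b) ^ 2 + e ^ 2 = 0 := by rw [← h0] at hs2; linarith
  have hb : b = -c := by nlinarith [sq_nonneg (c + b), sq_nonneg e]
  have he : e = 0 := by nlinarith [sq_nonneg (c + b), sq_nonneg e]
  subst hb he
  intro t ht
  have hdet := fundamentalMatrix_det hQ lam t
  have ht' := hdisc t ht
  -- Now `s = 2c`, so the squared entries sum to twice the determinant, which happens only for
  -- rotations.
  have hsum : fundamentalMatrix Q lam t 0 1 ^ 2 + fundamentalMatrix Q lam t 1 1 ^ 2 +
      (fundamentalMatrix Q lam t 0 0 ^ 2 + fundamentalMatrix Q lam t 1 0 ^ 2) = 2 := by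
    refine mul_left_cancel₀ hpos.ne' ?_
    linarith
  have hsq' : (fundamentalMatrix Q lam t 0 0 - fundamentalMatrix Q lam t 1 1) ^ 2 +
      (fundamentalMatrix Q lam t 1 0 + fundamentalMatrix Q lam t 0 1) ^ 2 = 0 := by
    linear_combination hsum - 2 * hdet
  have h1 : fundamentalMatrix Q lam t 0 0 - fundamentalMatrix Q lam t 1 1 = 0 := by
    nlinarith [sq_nonneg (fundamentalMatrix Q lam t 0 0 - fundamentalMatrix Q lam t 1 1),
      sq_nonneg (fundamentalMatrix Q lam t 1 0 + fundamentalMatrix Q lam t 0 1)]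
  have h2 : fundamentalMatrix Q lam t 1 0 + fundamentalMatrix Q lam t 0 1 = 0 := by
    nlinarith [sq_nonneg (fundamentalMatrix Q lam t 0 0 - fundamentalMatrix Q lam t 1 1),
      sq_nonneg (fundamentalMatrix Q lam t 1 0 + fundamentalMatrix Q lam t 0 1)]
  exact ⟨by linarith, by linarith⟩

/-- If the fundamental matrix is a rotation on a period, then `Q` is a multiple of the identity. -/
theorem IsPotential.eq_smul_one_of_rotation (hQ : IsPotential Q)
    (hrot : ∀ t ∈ Icc 0 π, fundamentalMatrix Q lam t 0 0 = fundamentalMatrix Q lam t 1 1 ∧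
      fundamentalMatrix Q lam t 1 0 = -fundamentalMatrix Q lam t 0 1) (z : ℝ) :
    Q z = ((Q z).trace / 2) • (1 : Matrix (Fin 2) (Fin 2) ℝ) := by
  -- Comparing derivatives needs a neighbourhood of `t`; the end points follow by continuity, the
  -- rest of the line by periodicity.
  have hopen : ∀ t ∈ Ioo 0 π, Q t 0 1 = 0 ∧ Q t 1 1 - Q t 0 0 = 0 := by
    intro t ht
    obtain ⟨h00, h10⟩ := (isSolution_iff hQ).mp (isSolution_fundamentalMatrix hQ lam 0) t
    obtain ⟨h01, h11⟩ := (isSolution_iff hQ).mp (isSolution_fundamentalMatrix hQ lam 1) t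
    have hev : ∀ᶠ s in 𝓝 t, s ∈ Ioo 0 π := Ioo_mem_nhds ht.1 ht.2
    have e1 := h00.unique (h11.congr_of_eventuallyEq (by
      filter_upwards [hev] with s hs using (hrot s (Ioo_subset_Icc_self hs)).1))
    have e2 := h10.unique (h01.neg.congr_of_eventuallyEq (by
      filter_upwards [hev] with s hs using (hrot s (Ioo_subset_Icc_self hs)).2))
    obtain ⟨r1, r2⟩ := hrot t (Ioo_subset_Icc_self ht)
    have hdet := fundamentalMatrix_det hQ lam t
    rw [← r1] at e1 e2 hdet
    rw [r2] at e1 e2 hdet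
    generalize fundamentalMatrix Q lam t 0 0 = x at *
    generalize fundamentalMatrix Q lam t 0 1 = y at *
    -- A homogeneous linear system for `2 Q₀₁` and `Q₁₁ - Q₀₀` with determinant `x² + y² = 1`.
    have f1 : 2 * Q t 0 1 * x = (Q t 1 1 - Q t 0 0) * y := by linarith
    have f2 : (Q t 1 1 - Q t 0 0) * x = -(2 * Q t 0 1 * y) := by linarith
    constructor
    · linear_combination -(Q t 0 1) * hdet + x / 2 * f1 + y / 2 * f2
    · linear_combination -(Q t 1 1 - Q t 0 0) * hdet + x * f2 - y * f1
  have hclosed : ∀ t ∈ Icc 0 π, Q t 0 1 = 0 ∧ Q t 1 1 - Q t 0 0 = 0 := by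
    have hset : IsClosed {t | Q t 0 1 = 0 ∧ Q t 1 1 - Q t 0 0 = 0} :=
      (isClosed_eq (hQ.continuous 0 1) continuous_const).inter
        (isClosed_eq ((hQ.continuous 1 1).sub (hQ.continuous 0 0)) continuous_const)
    rw [← closure_Ioo pi_ne_zero.symm]
    exact hset.closure_subset_iff.mpr hopen
  have hall : Q z 0 1 = 0 ∧ Q z 1 1 - Q z 0 0 = 0 := by
    obtain ⟨t, ht, h01, hd⟩ : ∃ t ∈ Ico 0 π, Q z 0 1 = Q t 0 1 ∧
        Q z 1 1 - Q z 0 0 = Q t 1 1 - Q t 0 0 := by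
      have hper : Function.Periodic (fun z => (Q z 0 1, Q z 1 1 - Q z 0 0)) π := fun z => by
        have h1 := hQ.periodic 0 1 z
        have h2 := hQ.periodic 1 1 z
        have h3 := hQ.periodic 0 0 z
        simp only at h1 h2 h3
        simp only [h1, h2, h3]
      obtain ⟨t, ht, he⟩ := hper.exists_mem_Ico₀ pi_pos z
      exact ⟨t, ht, congrArg Prod.fst he, congrArg Prod.snd he⟩
    rw [h01, hd]
    exact hclosed t (Ico_subset_Icc_self ht)
  ext i j
  rw [Matrix.trace_fin_two]
  have h10 := hQ.apply_one_zero z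
  fin_cases i <;> fin_cases j <;> simp <;> linarith [hall.1, hall.2]

end CanonicalSystem

namespace CanonicalSystem

variable {Q : ℝ → Matrix (Fin 2) (Fin 2) ℝ} {lam : ℝ} {n : ℤ}

/-! ### Instability intervals -/

theorem neg_one_zpow_sq (n : ℤ) : ((-1 : ℝ) ^ n) ^ 2 = 1 := by
  rcases Int.even_or_odd n with h | h
  · simp [h.neg_one_zpow]
  · simp [h.neg_one_zpow]

/-- The lower left entry vanishes, so the diagonal is `(-1)ⁿ R` and `(-1)ⁿ / R`, and `R + 1 / R ≥
2`. -/
theorem two_le_discriminant_mu (hQ : IsPotential Q) (n : ℤ) :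
    2 ≤ (-1 : ℝ) ^ n * discriminant Q (mu Q n) := by
  obtain ⟨R, hR, h0, h1⟩ := exists_fundamentalMatrix_eq_polar hQ (mu Q n) π
  rw [angularPart_mu hQ, cos_int_mul_pi] at h0
  rw [angularPart_mu hQ, sin_int_mul_pi, mul_zero] at h1
  have hdet := fundamentalMatrix_det hQ (mu Q n) π
  have hsq := neg_one_zpow_sq n
  rw [h0, h1] at hdet
  rw [discriminant_eq, h0]
  set x := (-1 : ℝ) ^ n * fundamentalMatrix Q (mu Q n) π 1 1 with hx
  have hRx : R * x = 1 := by rw [hx]; linarith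
  have hxpos : 0 < x := pos_of_mul_pos_right (by linarith) hR.le
  have : (-1 : ℝ) ^ n * (R * (-1) ^ n + fundamentalMatrix Q (mu Q n) π 1 1) = R + x := by
    linear_combination R * hsq
  rw [this]
  nlinarith [sq_nonneg (R - x)]

theorem discriminant_mu_add_one_le (hQ : IsPotential Q) (n : ℤ) :
    (-1 : ℝ) ^ n * discriminant Q (mu Q (n + 1)) ≤ -2 := by
  have := two_le_discriminant_mu hQ (n + 1)
  rw [zpow_add_one₀ (by norm_num)] at this
  linarith

theorem discriminant_mu_sub_one_le (hQ : IsPotential Q) (n : ℤ) :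
    (-1 : ℝ) ^ n * discriminant Q (mu Q (n - 1)) ≤ -2 := by
  have := two_le_discriminant_mu hQ (n - 1)
  rw [zpow_sub_one₀ (by norm_num), inv_neg_one] at this
  linarith

/-- The angle at `π` lies strictly between `nπ` and `(n + 1)π`, which fixes the sign of its sine. -/
theorem fundamentalMatrix_one_zero_pos (hQ : IsPotential Q)
    (h : lam ∈ Ioo (mu Q n) (mu Q (n + 1))) :
    0 < (-1 : ℝ) ^ n * fundamentalMatrix Q lam π 1 0 := by
  obtain ⟨R, hR, -, h1⟩ := exists_fundamentalMatrix_eq_polar hQ lam π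
  have hl := strictMono_angularPart hQ 0 h.1
  have hr := strictMono_angularPart hQ 0 h.2
  simp only [angularPart_mu hQ] at hl hr
  push_cast at hr
  have hsin := sin_pos_of_pos_of_lt_pi (x := angularPart Q lam 0 π - n * π) (by linarith)
    (by linarith)
  rw [sin_sub_int_mul_pi] at hsin
  rw [h1]
  nlinarith

/-- The closure of the `n`-th instability interval: the component of `{(-1)ⁿ Δ ≥ 2}` that
contains `μ_n`. -/
noncomputable def gapComponent (Q : ℝ → Matrix (Fin 2) (Fin 2) ℝ) (n : ℤ) : Set ℝ :=
  connectedComponentIn {x : ℝ | 2 ≤ (-1 : ℝ) ^ n * discriminant Q x} (mu Q n)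

theorem periodicComponent_eq (Q : ℝ → Matrix (Fin 2) (Fin 2) ℝ) (k : ℤ) :
    periodicComponent Q k = gapComponent Q (2 * k) := by
  rw [periodicComponent, gapComponent, (even_two_mul k).neg_one_zpow]
  simp only [one_mul]

theorem antiperiodicComponent_eq (Q : ℝ → Matrix (Fin 2) (Fin 2) ℝ) (k : ℤ) :
    antiperiodicComponent Q k = gapComponent Q (2 * k - 1) := by
  have h : Odd (2 * k - 1) := ⟨k - 1, by ring⟩
  rw [antiperiodicComponent, gapComponent, h.neg_one_zpow]
  congr 1
  ext x
  simp only [mem_ofPred_eq]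
  constructor <;> intro h <;> linarith

theorem periodicEigenvalue_two_mul (Q : ℝ → Matrix (Fin 2) (Fin 2) ℝ) (k : ℤ) :
    periodicEigenvalue Q (2 * k) = sSup (gapComponent Q (2 * k)) := by
  rw [periodicEigenvalue, if_pos (even_two_mul k), periodicComponent_eq]
  simp

theorem periodicEigenvalue_two_mul_sub_one (Q : ℝ → Matrix (Fin 2) (Fin 2) ℝ) (k : ℤ) :
    periodicEigenvalue Q (2 * k - 1) = sInf (gapComponent Q (2 * k)) := by
  have h : ¬ Even (2 * k - 1) := Int.not_even_iff_odd.mpr ⟨k - 1, by ring⟩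
  rw [periodicEigenvalue, if_neg h, periodicComponent_eq]
  simp

theorem antiperiodicEigenvalue_two_mul (Q : ℝ → Matrix (Fin 2) (Fin 2) ℝ) (k : ℤ) :
    antiperiodicEigenvalue Q (2 * k) = sSup (gapComponent Q (2 * k - 1)) := by
  rw [antiperiodicEigenvalue, if_pos (even_two_mul k), antiperiodicComponent_eq]
  simp

theorem antiperiodicEigenvalue_two_mul_sub_one (Q : ℝ → Matrix (Fin 2) (Fin 2) ℝ) (k : ℤ) :
    antiperiodicEigenvalue Q (2 * k - 1) = sInf (gapComponent Q (2 * k - 1)) := by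
  have h : ¬ Even (2 * k - 1) := Int.not_even_iff_odd.mpr ⟨k - 1, by ring⟩
  rw [antiperiodicEigenvalue, if_neg h, antiperiodicComponent_eq]
  simp

theorem instabilityInterval_eq (Q : ℝ → Matrix (Fin 2) (Fin 2) ℝ) (n : ℤ) :
    instabilityInterval Q n = Ioo (sInf (gapComponent Q n)) (sSup (gapComponent Q n)) := by
  rcases Int.even_or_odd' n with ⟨k, rfl | rfl⟩
  · rw [instabilityInterval, if_pos (even_two_mul k), periodicEigenvalue_two_mul,
      periodicEigenvalue_two_mul_sub_one]
  · have h : ¬ Even (2 * k + 1) := Int.not_even_iff_odd.mpr ⟨k, rfl⟩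
    have e₁ : 2 * k + 1 = 2 * (k + 1) - 1 := by ring
    have e₂ : 2 * k + 1 + 1 = 2 * (k + 1) := by ring
    rw [instabilityInterval, if_neg h, e₂, e₁, antiperiodicEigenvalue_two_mul,
      antiperiodicEigenvalue_two_mul_sub_one]

theorem mu_mem_gapComponent (hQ : IsPotential Q) (n : ℤ) : mu Q n ∈ gapComponent Q n :=
  mem_connectedComponentIn (two_le_discriminant_mu hQ n)

/-- At the neighbours `mu Q (n ± 1)` the sign is opposite, so an interval in the set cannot pass
them. The boundedness makes `sInf` and `sSup` genuine end points. -/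
theorem gapComponent_subset_Icc (hQ : IsPotential Q) (n : ℤ) :
    gapComponent Q n ⊆ Icc (mu Q (n - 1)) (mu Q (n + 1)) := by
  intro x hx
  have hconn : (gapComponent Q n).OrdConnected :=
    isPreconnected_connectedComponentIn.ordConnected
  have hsub : gapComponent Q n ⊆ {x : ℝ | 2 ≤ (-1 : ℝ) ^ n * discriminant Q x} :=
    connectedComponentIn_subset _ _
  have hmem := mu_mem_gapComponent hQ n
  have hl : mu Q (n - 1) < mu Q n := strictMono_mu hQ (by omega)
  have hr : mu Q n < mu Q (n + 1) := strictMono_mu hQ (by omega)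
  constructor
  · by_contra! hlt
    have h₁ := hsub (hconn.out hx hmem ⟨hlt.le, hl.le⟩)
    have h₂ := discriminant_mu_sub_one_le hQ n
    simp only [mem_ofPred_eq] at h₁
    linarith
  · by_contra! hlt
    have h₁ := hsub (hconn.out hmem hx ⟨hr.le, hlt.le⟩)
    have h₂ := discriminant_mu_add_one_le hQ n
    simp only [mem_ofPred_eq] at h₁
    linarith

theorem gapComponent_eq_singleton (hQ : IsPotential Q) (h : instabilityInterval Q n = ∅) :
    gapComponent Q n = {mu Q n} := by
  have hmem := mu_mem_gapComponent hQ n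
  have hsub := gapComponent_subset_Icc hQ n
  have hbelow : BddBelow (gapComponent Q n) := bddBelow_Icc.mono hsub
  have habove : BddAbove (gapComponent Q n) := bddAbove_Icc.mono hsub
  rw [instabilityInterval_eq, Ioo_eq_empty_iff, not_lt] at h
  refine eq_singleton_iff_unique_mem.mpr ⟨hmem, fun x hx => le_antisymm ?_ ?_⟩
  · exact (le_csSup habove hx).trans (h.trans (csInf_le hbelow hmem))
  · exact (le_csSup habove hmem).trans (h.trans (csInf_le hbelow hx))

/-! ### The bands of stability -/

/-- `(-1)ⁿ Δ` decreases at each crossing of level `2` in the band, so once below it never returns. A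
value of at least `2` at `lam` would put all of `[mu Q n, lam]` in the component. -/
theorem discriminant_lt_two (hQ : IsPotential Q) (hgap : gapComponent Q n = {mu Q n})
    (h : lam ∈ Ioo (mu Q n) (mu Q (n + 1))) : (-1 : ℝ) ^ n * discriminant Q lam < 2 := by
  by_contra! hge
  have hsub : Icc (mu Q n) lam ⊆ gapComponent Q n := by
    refine isPreconnected_Icc.subset_connectedComponentIn ⟨le_rfl, h.1.le⟩ fun x hx => ?_
    rw [mem_ofPred_eq]
    rcases hx.1.eq_or_lt with rfl | hx1
    · exact two_le_discriminant_mu hQ n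
    rcases hx.2.eq_or_lt with rfl | hx2
    · exact hge
    by_contra! hlt
    refine absurd (lt_of_deriv_neg_of_eq hx2
      (fun t _ => hasDerivAt_mul_discriminant hQ t ((-1 : ℝ) ^ n)) hlt.le fun t ht htB => ?_)
      (not_lt.mpr hge)
    rw [neg_lt_zero]
    exact integral_discriminantDensity_pos hQ (neg_one_zpow_sq n)
      (fundamentalMatrix_one_zero_pos hQ ⟨hx1.trans_le ht.1, ht.2.trans_lt h.2⟩)
      (by rw [htB]; norm_num)
  rw [hgap] at hsub
  exact h.1.ne' (hsub ⟨h.1.le, le_rfl⟩)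

/-- The mirror case: having reached `-2`, the function stays below it up to `mu Q (n + 1)`, which
would make the next component nondegenerate. -/
theorem neg_two_lt_discriminant (hQ : IsPotential Q)
    (hgap : gapComponent Q (n + 1) = {mu Q (n + 1)})
    (h : lam ∈ Ioo (mu Q n) (mu Q (n + 1))) : -2 < (-1 : ℝ) ^ n * discriminant Q lam := by
  by_contra! hle
  have hsub : Icc lam (mu Q (n + 1)) ⊆ gapComponent Q (n + 1) := by
    refine isPreconnected_Icc.subset_connectedComponentIn ⟨h.2.le, le_rfl⟩ fun x hx => ?_
    suffices hx' : (-1 : ℝ) ^ n * discriminant Q x ≤ -2 by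
      rw [mem_ofPred_eq, zpow_add_one₀ (by norm_num)]
      linarith
    rcases hx.1.eq_or_lt with rfl | hx1
    · exact hle
    rcases hx.2.eq_or_lt with rfl | hx2
    · exact discriminant_mu_add_one_le hQ n
    refine (lt_of_deriv_neg_of_eq hx1
      (fun t _ => hasDerivAt_mul_discriminant hQ t ((-1 : ℝ) ^ n)) hle fun t ht htB => ?_).le
    rw [neg_lt_zero]
    exact integral_discriminantDensity_pos hQ (neg_one_zpow_sq n)
      (fundamentalMatrix_one_zero_pos hQ ⟨h.1.trans_le ht.1, ht.2.trans_lt hx2⟩)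
      (by rw [htB]; norm_num)
  rw [hgap] at hsub
  exact h.2.ne (hsub ⟨le_rfl, h.2.le⟩)

/-- A stability interval between two collapsed gaps has length at most one, and length one only
if `Q` is a multiple of the identity. -/
theorem mu_sub_le_one_and_eq_smul_one (hQ : IsPotential Q)
    (hgap : gapComponent Q n = {mu Q n}) (hgap' : gapComponent Q (n + 1) = {mu Q (n + 1)}) :
    mu Q (n + 1) - mu Q n ≤ 1 ∧ (mu Q (n + 1) - mu Q n = 1 →
      ∀ z, Q z = ((Q z).trace / 2) • (1 : Matrix (Fin 2) (Fin 2) ℝ)) := by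
  have hlt : mu Q n < mu Q (n + 1) := strictMono_mu hQ (by omega)
  have hc : Continuous fun x => (-1 : ℝ) ^ n * discriminant Q x :=
    continuous_iff_continuousAt.mpr fun x =>
      (hasDerivAt_mul_discriminant hQ x ((-1 : ℝ) ^ n)).continuousAt
  have hbound : ∀ x ∈ Ioo (mu Q n) (mu Q (n + 1)),
      -2 < (-1 : ℝ) ^ n * discriminant Q x ∧ (-1 : ℝ) ^ n * discriminant Q x < 2 := fun x hx =>
    ⟨neg_two_lt_discriminant hQ hgap' hx, discriminant_lt_two hQ hgap hx⟩
  have hder : ∀ x ∈ Ioo (mu Q n) (mu Q (n + 1)),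
      HasDerivAt (fun x => arccos ((-1 : ℝ) ^ n * discriminant Q x / 2))
        ((∫ t in (0 : ℝ)..π, discriminantDensity Q x ((-1 : ℝ) ^ n) t) /
          √(4 - ((-1 : ℝ) ^ n * discriminant Q x) ^ 2)) x := fun x hx => by
    obtain ⟨h₁, h₂⟩ := hbound x hx
    have h := (hasDerivAt_arccos (x := (-1 : ℝ) ^ n * discriminant Q x / 2) (by linarith)
      (by linarith)).comp x ((hasDerivAt_mul_discriminant hQ x ((-1 : ℝ) ^ n)).div_const 2)
    refine h.congr_deriv ?_
    have hs : √(1 - ((-1 : ℝ) ^ n * discriminant Q x / 2) ^ 2) =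
        √(4 - ((-1 : ℝ) ^ n * discriminant Q x) ^ 2) / 2 := by
      rw [show 1 - ((-1 : ℝ) ^ n * discriminant Q x / 2) ^ 2 =
        (4 - ((-1 : ℝ) ^ n * discriminant Q x) ^ 2) / 2 ^ 2 by ring,
        sqrt_div' _ (by positivity), sqrt_sq (by norm_num)]
    rw [hs]
    have hpos : √(4 - ((-1 : ℝ) ^ n * discriminant Q x) ^ 2) ≠ 0 :=
      (sqrt_pos.mpr (by nlinarith)).ne'
    field_simp
  obtain ⟨x, hx, hslope⟩ := exists_hasDerivAt_eq_slope _ _ hlt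
    (continuous_arccos.comp (hc.div_const 2)).continuousOn hder
  -- Only `Δ ≥ 2` in absolute value is known at the ends; `arccos` is constant beyond `[-1, 1]`, so
  -- its values are still `0` and `π`.
  have ha : arccos ((-1 : ℝ) ^ n * discriminant Q (mu Q n) / 2) = 0 :=
    arccos_of_one_le (by linarith [two_le_discriminant_mu hQ n])
  have hb : arccos ((-1 : ℝ) ^ n * discriminant Q (mu Q (n + 1)) / 2) = π :=
    arccos_of_le_neg_one (by linarith [discriminant_mu_add_one_le hQ n])
  simp only [Function.comp_apply, ha, hb, sub_zero] at hslope
  obtain ⟨h₁, h₂⟩ := hbound x hx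
  have hspos : 0 < √(4 - ((-1 : ℝ) ^ n * discriminant Q x) ^ 2) := sqrt_pos.mpr (by nlinarith)
  have hΔ : ((-1 : ℝ) ^ n * discriminant Q x) ^ 2 ≤ 4 := by nlinarith
  have hlen : 0 < mu Q (n + 1) - mu Q n := sub_pos.mpr hlt
  have hpos := fundamentalMatrix_one_zero_pos hQ hx
  have hle := pi_mul_sqrt_le_integral hQ (neg_one_zpow_sq n) hpos hΔ
  rw [← le_div_iff₀ hspos, hslope, le_div_iff₀ hlen] at hle
  refine ⟨by nlinarith [pi_pos], fun hone => ?_⟩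
  -- For length one the mean slope is `π`, so the lower bound is attained at the single parameter
  -- `x`, and that suffices for rigidity.
  rw [hone, div_one, div_eq_iff hspos.ne'] at hslope
  exact hQ.eq_smul_one_of_rotation
    (fundamentalMatrix_rotation_of_integral_le hQ (neg_one_zpow_sq n) hpos hΔ hslope.le)

/-- An antitone sequence over `ℤ` with the same limit at both ends is constant; here it is squeezed
between the indices `-m` and `m`. -/
theorem mu_eq_of_gapComponent_eq_singleton (hQ : IsPotential Q)
    (hgap : ∀ n, gapComponent Q n = {mu Q n}) (n : ℤ) :
    mu Q n = n + 1 / π * ∫ t in (0 : ℝ)..π, (Q t).trace / 2 := by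
  set c := 1 / π * ∫ t in (0 : ℝ)..π, (Q t).trace / 2 with hc
  have hanti : Antitone fun n : ℤ => mu Q n - n := antitone_int_of_succ_le fun n => by
    have := (mu_sub_le_one_and_eq_smul_one hQ (hgap n) (hgap (n + 1))).1
    push_cast
    linarith
  refine eq_of_forall_dist_le fun ε hε => ?_
  obtain ⟨N, hN⟩ := exists_abs_mu_sub_le hQ hε
  obtain ⟨m, hm⟩ := exists_nat_ge (max N |(n : ℝ)|)
  have hmN : N ≤ m := (le_max_left _ _).trans hm
  have hmn := abs_le.mp ((le_max_right _ _).trans hm)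
  have hr := hN m (by simpa using hmN)
  have hl := hN (-m) (by simpa using hmN)
  have h₁ := hanti (show n ≤ m by exact_mod_cast hmn.2)
  have h₂ := hanti (show -(m : ℤ) ≤ n by exact_mod_cast hmn.1)
  simp only at h₁ h₂
  rw [← hc] at hr hl
  have hr' := abs_le.mp hr
  have hl' := abs_le.mp hl
  rw [Real.dist_eq, abs_le]
  constructor <;> linarith

end CanonicalSystem

theorem lemma6p2 (Q : ℝ → Matrix (Fin 2) (Fin 2) ℝ)
    (hQ : CanonicalSystem.IsPotential Q)
    (hvanish : ∀ n : ℤ, CanonicalSystem.instabilityInterval Q n = ∅)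
    (p : ℝ → ℝ) (hp : ∀ z, p z = (Q z).trace / 2) :
    (∀ z, Q z = p z • (1 : Matrix (Fin 2) (Fin 2) ℝ)) ∧
    ∀ k : ℤ,
      CanonicalSystem.periodicEigenvalue Q (2 * k - 1) =
          2 * (k : ℝ) + (1 / π) * ∫ t in (0 : ℝ)..π, p t ∧
      CanonicalSystem.periodicEigenvalue Q (2 * k) =
          2 * (k : ℝ) + (1 / π) * ∫ t in (0 : ℝ)..π, p t ∧
      1 + CanonicalSystem.antiperiodicEigenvalue Q (2 * k - 1) =
          2 * (k : ℝ) + (1 / π) * ∫ t in (0 : ℝ)..π, p t ∧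
      1 + CanonicalSystem.antiperiodicEigenvalue Q (2 * k) =
          2 * (k : ℝ) + (1 / π) * ∫ t in (0 : ℝ)..π, p t := by
  have hgap : ∀ n, CanonicalSystem.gapComponent Q n = {CanonicalSystem.mu Q n} := fun n =>
    CanonicalSystem.gapComponent_eq_singleton hQ (hvanish n)
  have hmu := CanonicalSystem.mu_eq_of_gapComponent_eq_singleton hQ hgap
  obtain rfl : p = fun z => (Q z).trace / 2 := funext hp
  -- Every band has length one, so any single band, here the one with index `0`, yields the form of
  -- `Q`.
  refine ⟨(CanonicalSystem.mu_sub_le_one_and_eq_smul_one hQ (hgap 0) (hgap (0 + 1))).2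
    (by rw [hmu, hmu]; push_cast; ring), fun k => ?_⟩
  rw [CanonicalSystem.periodicEigenvalue_two_mul,
    CanonicalSystem.periodicEigenvalue_two_mul_sub_one,
    CanonicalSystem.antiperiodicEigenvalue_two_mul,
    CanonicalSystem.antiperiodicEigenvalue_two_mul_sub_one, hgap, hgap,
    csInf_singleton, csSup_singleton, csInf_singleton, csSup_singleton, hmu, hmu]
  push_cast
  refine ⟨rfl, rfl, ?_, ?_⟩ <;> ring
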